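/- Let $n\ge 1$, let $\mathcal F f(\xi)=\widehat f(\xi)=(2\pi)^{-n/2}\int_{\mathbb R^n} f(x)e^{-ix\cdot\xi}\,dx$ (extended to $L^2(\mathbb R^n)$ and to tempered distributions), and let $U_0(t)=e^{i\frac t2\Delta}$ be the free Schrödinger group. For every $\phi\in L^2(\mathbb R^n)$ and for each choice of the sign $\pm$, $$\int_0^{\pm\infty} e^{it\frac{|x|^2}{2}}\,\mathcal F\left(|U_0(t)\phi|^{4/n}U_0(t)\phi\right)dt=\int_0^{\pm\infty} U_0(t)\left(|U_0(-t)\widehat\phi|^{4/n}U_0(-t)\widehat\phi\right)dt .$$ Here both integrals exist as elements of $L^2(\mathbb R^n)$ in the following sense: for almost every $t$ the functions $|U_0(t)\phi|^{4/n}U_0(t)\phi$ and $|U_0(-t)\widehat\phi|^{4/n}U_0(-t)\widehat\phi$ define tempered distributions, so that the integrands are tempered distributions for almost every $t$; tested against any Schwartz function the integrals converge absolutely and represent an element of $L^2(\mathbb R^n)$; and the integrals over $(0,T)$ belong to $L^2(\mathbb R^n)$ and converge in the norm of $L^2(\mathbb R^n)$ as $T\to\pm\infty$. -/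

import Mathlib

open MeasureTheory Filter Topology Set
open scoped SchwartzMap FourierTransform ENNReal

noncomputable section

namespace CriticalNLS

/-- Euclidean space `ℝⁿ`. -/
abbrev Rn (n : ℕ) : Type := EuclideanSpace ℝ (Fin n)

/-- The Hilbert space `L²(ℝⁿ; ℂ)`. -/
abbrev L2 (n : ℕ) : Type := Lp ℂ 2 (volume : Measure (Rn n))

variable {n : ℕ}

/-! ### The Fourier transform `(2π)^{-n/2} ∫ f(x) e^{-i x·ξ} dx`

Mathlib's `𝓕 f (ξ) = ∫ f(x) e^{-2π i x·ξ} dx`, so the transform used here is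
`(2π)^{-n/2} (𝓕 f)(ξ / 2π)`. -/

/-- The constant `(2π)^{-n/2}`. -/
def fourierConst (n : ℕ) : ℂ := (((2 * Real.pi) ^ (-(n : ℝ) / 2) : ℝ) : ℂ)

/-- The dilation `ξ ↦ ξ / 2π` of `ℝⁿ`. -/
def dilation (n : ℕ) : Rn n ≃L[ℝ] Rn n :=
  ContinuousLinearEquiv.smulLeft (Units.mk0 ((2 * Real.pi)⁻¹ : ℝ) (by positivity))

lemma dilation_apply (ξ : Rn n) : dilation n ξ = (2 * Real.pi)⁻¹ • ξ := rfl

/-- The Fourier transform `(2π)^{-n/2} ∫ ψ(x) e^{-i x·ξ} dx` on Schwartz functions. -/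
def fourierSchwartz (n : ℕ) : 𝓢(Rn n, ℂ) →L[ℂ] 𝓢(Rn n, ℂ) :=
  fourierConst n • (SchwartzMap.compCLMOfContinuousLinearEquiv ℂ (dilation n) ∘L
    FourierTransform.fourierCLM ℂ 𝓢(Rn n, ℂ))

/-- The Fourier transform on tempered distributions, `⟨ℱT, ψ⟩ = ⟨T, ℱψ⟩`. -/
def fourierDist (n : ℕ) : 𝓢'(Rn n, ℂ) →L[ℂ] 𝓢'(Rn n, ℂ) :=
  PointwiseConvergenceCLM.precomp ℂ (fourierSchwartz n)

lemma memLp_comp_dilation (φ : L2 n) :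
    MemLp (fun ξ : Rn n => fourierConst n * φ (dilation n ξ)) 2 volume := by
  have hc : ((2 * Real.pi)⁻¹ : ℝ) ≠ 0 := by positivity
  have hmap : Measure.map (fun ξ : Rn n => dilation n ξ) volume
      = ENNReal.ofReal |((((2 * Real.pi)⁻¹ : ℝ)) ^ Module.finrank ℝ (Rn n))⁻¹| •
        (volume : Measure (Rn n)) := Measure.map_addHaar_smul volume hc
  refine MemLp.const_mul ?_ _
  refine MemLp.comp_of_map (f := fun ξ : Rn n => dilation n ξ) ?_
    (dilation n).continuous.measurable.aemeasurable
  rw [hmap]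
  exact (Lp.memLp φ).smul_measure ENNReal.ofReal_ne_top

/-- The Fourier transform `φ ↦ φ̂` on `L²`. -/
def fourierL2 (φ : L2 n) : L2 n := (memLp_comp_dilation (𝓕 φ : L2 n)).toLp _

/-! ### The free Schrödinger group `U₀(t) = e^{i t Δ / 2}` -/

/-- The Fourier symbol of `e^{i t Δ / 2}`. In Mathlib's normalization `Δ` is the Fourier multiplier
with symbol `-(2π)² |ξ|²`. -/
def freeSymbol (t : ℝ) (ξ : Rn n) : ℂ :=
  Complex.exp (-(Complex.I * ((t / 2 * ((2 * Real.pi) ^ 2 * ‖ξ‖ ^ 2) : ℝ) : ℂ)))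

lemma memLp_freeSymbol_mul (t : ℝ) (φ : L2 n) :
    MemLp (fun ξ : Rn n => freeSymbol t ξ * φ ξ) 2 volume := by
  have hcont : Continuous (freeSymbol t : Rn n → ℂ) := by unfold freeSymbol; fun_prop
  refine (Lp.memLp φ).of_le (hcont.aestronglyMeasurable.mul (Lp.aestronglyMeasurable φ)) ?_
  refine Eventually.of_forall fun ξ => le_of_eq ?_
  have h : ‖freeSymbol t ξ‖ = 1 := by
    rw [freeSymbol, mul_comm, ← neg_mul, ← Complex.ofReal_neg, Complex.norm_exp_ofReal_mul_I]
  rw [norm_mul, h, one_mul]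

/-- `U₀(t) = e^{i t Δ / 2}` on `L²`. -/
def freeFlow (t : ℝ) (φ : L2 n) : L2 n :=
  𝓕⁻ ((memLp_freeSymbol_mul t (𝓕 φ : L2 n)).toLp _ : L2 n)

/-- `U₀(t) = e^{i t Δ / 2}` on tempered distributions. -/
def freeFlowDist (t : ℝ) : 𝓢'(Rn n, ℂ) →L[ℂ] 𝓢'(Rn n, ℂ) :=
  TemperedDistribution.fourierMultiplierCLM ℂ (freeSymbol t)

/-- Multiplication of tempered distributions by `e^{i t |x|² / 2}`. -/
def chirpMul (t : ℝ) : 𝓢'(Rn n, ℂ) →L[ℂ] 𝓢'(Rn n, ℂ) :=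
  TemperedDistribution.smulLeftCLM ℂ
    (fun x : Rn n => Complex.exp (Complex.I * ((t * ‖x‖ ^ 2 / 2 : ℝ) : ℂ)))

/-! ### The `L²`-critical nonlinearity -/

/-- The function `|u|^{4/n} u`. -/
def criticalPower (u : L2 n) : Rn n → ℂ :=
  fun x => ((‖u x‖ ^ (4 / (n : ℝ)) : ℝ) : ℂ) * u x

/-- The tempered distribution `T` is given by integration against the function `f`. -/
def Represents (T : 𝓢'(Rn n, ℂ)) (f : Rn n → ℂ) : Prop :=
  ∀ ψ : 𝓢(Rn n, ℂ), Integrable (fun x => ψ x * f x) volume ∧ T ψ = ∫ x, ψ x * f x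

/-- The function `f` defines a tempered distribution by integration. -/
def IsTempered (f : Rn n → ℂ) : Prop := ∃ T : 𝓢'(Rn n, ℂ), Represents T f

open Classical in
/-- The tempered distribution defined by the function `f` (zero if there is none). -/
def distOf (f : Rn n → ℂ) : 𝓢'(Rn n, ℂ) := if h : IsTempered f then h.choose else 0

/-! ### Time integrals of families of tempered distributions -/

/-- `I ∈ L²` is the integral `∫₀^{+∞} f(t) dt`: tested against Schwartz functions, the integral
converges absolutely and has the value `I`; moreover the integrals `∫₀^T f(t) dt` belong to `L²` and
converge to `I` in the norm of `L²` as `T → +∞`. -/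
structure HasIntegralToTop (f : ℝ → 𝓢'(Rn n, ℂ)) (I : L2 n) : Prop where
  integrable : ∀ ψ : 𝓢(Rn n, ℂ), IntegrableOn (fun t => f t ψ) (Ioi 0) volume
  integral_eq : ∀ ψ : 𝓢(Rn n, ℂ), ∫ t in Ioi (0 : ℝ), f t ψ = (I : 𝓢'(Rn n, ℂ)) ψ
  tendsto : ∃ J : ℝ → L2 n,
    (∀ T > 0, ∀ ψ : 𝓢(Rn n, ℂ), ∫ t in Ioc 0 T, f t ψ = (J T : 𝓢'(Rn n, ℂ)) ψ) ∧
    Tendsto J atTop (𝓝 I)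

/-- `I ∈ L²` is the integral `∫₀^{-∞} f(t) dt = -∫₀^{+∞} f(-t) dt`. -/
def HasIntegralToBot (f : ℝ → 𝓢'(Rn n, ℂ)) (I : L2 n) : Prop :=
  HasIntegralToTop (fun t => f (-t)) (-I)

/-- The integrand `e^{i t |x|² / 2} ℱ(|U₀(t)φ|^{4/n} U₀(t)φ)`. -/
def leftIntegrand (φ : L2 n) (t : ℝ) : 𝓢'(Rn n, ℂ) :=
  chirpMul t (fourierDist n (distOf (criticalPower (freeFlow t φ))))

/-- The integrand `U₀(t)(|U₀(-t)φ̂|^{4/n} U₀(-t)φ̂)`. -/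
def rightIntegrand (φ : L2 n) (t : ℝ) : 𝓢'(Rn n, ℂ) :=
  freeFlowDist t (distOf (criticalPower (freeFlow (-t) (fourierL2 φ))))

end CriticalNLS

end

namespace CriticalNLS

/-! ### One-dimensional power integrals -/

/-! The free flow has the kernel (2πit)^{-n/2} e^{i|x-y|²/2t}. Expanding the square gives the
pseudoconformal identity U₀(t)φ(x) = (it)^{-n/2} e^{i|x|²/2t} (U₀(-1/t)φ̂)(x/t), proved for Schwartz
data in `freeSchwartz_eq_conformal` and by density in `freeFlow_ae_eq_conformal`. The map u ↦
|u|^{4/n}u commutes with phases and is homogeneous of degree 1 + 4/n, so it respects this identity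
up to one extra factor (|t|^{-n/2})^{4/n} = |t|^{-2}. This is exactly the Jacobian of t ↦ 1/t.

Tested against a Schwartz function ψ, the left integrand is `pairing φ t ψ̂`, because ℱ turns
multiplication by e^{it|x|²/2} into U₀(-t); the right integrand is `pairing φ̂ (-t) ψ`. In
`pairing_conformal` the chirps cancel, the powers |t|^{±n} cancel, and only |t|^{-2} is left, so
inverting time on a half-line identifies the two integrals (`integral_pairing_conformal`).

Existence in L² is the dual Strichartz estimate with q = 2 + 4/n and its conjugate exponent q'. The
dispersive estimate (`enorm_freeFlow_le`) is interpolated with the L² isometry by a Marcinkiewicz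
argument, which bounds U₀(t) from L^{q'} to L^q by a multiple of |t|^{-2/q}. The TT* method with the
Hardy–Littlewood–Sobolev inequality in time then puts free solutions in L^q(ℝ × ℝⁿ), hence the
nonlinearity in L^{q'}(ℝ × ℝⁿ) (`exists_nonlinearity`). By Hölder, its time integrals over any set
of times are bounded functionals of ψ in the L² norm, so Riesz represents them
(`exists_L2_setIntegral`). The bound involves only the L^{q'} norm over that set of times, so tails
vanish and the integrals converge in norm. -/

lemma lintegral_comp_abs_sub (G : ℝ → ℝ≥0∞) (hG : Measurable G) (s : ℝ) :
    ∫⁻ t, G |t - s| = 2 * ∫⁻ r in Ioi 0, G r := by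
  rw [lintegral_sub_right_eq_self (fun t => G |t|) s]
  have hm : Measurable fun t : ℝ => G |t| := hG.comp measurable_abs
  have h1 : ∫⁻ t in Ioi 0, G |t| = ∫⁻ r in Ioi 0, G r :=
    setLIntegral_congr_fun measurableSet_Ioi fun t ht => by rw [abs_of_pos ht]
  have h2 : ∫⁻ t in Iio 0, G |t| = ∫⁻ r in Ioi 0, G r := by
    rw [← h1, ← lintegral_indicator measurableSet_Iio, ← lintegral_indicator measurableSet_Ioi,
      ← lintegral_neg_eq_self]
    refine lintegral_congr fun t => ?_
    by_cases ht : 0 < t <;> simp [indicator, ht]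
  rw [← lintegral_add_compl _ (measurableSet_Ioi (a := (0 : ℝ))), compl_Ioi,
    setLIntegral_congr (Iio_ae_eq_Iic (a := (0 : ℝ))).symm, h1, h2, two_mul]

lemma setLIntegral_Ioc_rpow {s R : ℝ} (hs : -1 < s) (hR : 0 ≤ R) :
    ∫⁻ r in Ioc 0 R, ENNReal.ofReal (r ^ s) = ENNReal.ofReal (R ^ (s + 1) / (s + 1)) := by
  rw [← ofReal_integral_eq_lintegral_ofReal]
  · rw [← intervalIntegral.integral_of_le hR, integral_rpow (Or.inl hs),
      Real.zero_rpow (by linarith), sub_zero]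
  · exact (intervalIntegrable_iff_integrableOn_Ioc_of_le hR).1
      (intervalIntegral.intervalIntegrable_rpow' hs)
  · filter_upwards [self_mem_ae_restrict measurableSet_Ioc] with r hr
    exact Real.rpow_nonneg hr.1.le _

lemma setLIntegral_Ioi_rpow {s R : ℝ} (hs : s < -1) (hR : 0 < R) :
    ∫⁻ r in Ioi R, ENNReal.ofReal (r ^ s) = ENNReal.ofReal (-R ^ (s + 1) / (s + 1)) := by
  rw [← ofReal_integral_eq_lintegral_ofReal (integrableOn_Ioi_rpow_of_lt hs hR),
    integral_Ioi_rpow_of_lt hs hR]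
  filter_upwards [self_mem_ae_restrict measurableSet_Ioi] with r hr
  exact Real.rpow_nonneg (hR.trans hr).le _

/-! ### The symmetric Hardy–Littlewood–Sobolev inequality on the line -/

/-- The Riesz kernel `|r|^{-2/q}` on the line. -/
noncomputable def rieszKernel (q r : ℝ) : ℝ≥0∞ := ENNReal.ofReal (|r| ^ (-(2 / q)))

lemma measurable_rieszKernel (q : ℝ) : Measurable (rieszKernel q) := by
  unfold rieszKernel; fun_prop

lemma rieszKernel_sub_comm (q s t : ℝ) : rieszKernel q (t - s) = rieszKernel q (s - t) := by
  rw [rieszKernel, rieszKernel, abs_sub_comm]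

/-- The constant in the symmetric Hardy–Littlewood–Sobolev inequality. -/
noncomputable def hlsConst (q : ℝ) : ℝ := 2 / (1 - 2 / q) + 2 ^ (1 / q)

/-- Where a ≤ M, the part |t - s| ≤ R is bounded by M times the local integral of the kernel, and
the part |t - s| > R by Hölder, since the kernel is in L^q away from 0. -/
lemma setLIntegral_sublevel_mul_rieszKernel_le {p q : ℝ} (hpq : p.HolderConjugate q) (hq : 2 < q)
    {a : ℝ → ℝ≥0∞} (ha : Measurable a) {N M : ℝ} (hN : 0 < N) (hM : 0 < M)
    (haN : ∫⁻ t, a t ^ p = ENNReal.ofReal N) (s : ℝ) :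
    ∫⁻ t in {t | a t ≤ ENNReal.ofReal M}, a t * rieszKernel q (t - s)
      ≤ ENNReal.ofReal (hlsConst q * N ^ (1 - 2 / q) * M ^ (p - 1)) := by
  have hp0 : 0 < p := hpq.pos
  have hq0 : 0 < q := by linarith
  have hγ : 2 / q < 1 := by rw [div_lt_one hq0]; exact hq
  -- This radius balances the near part, of size M R^{1-2/q}, against the far part, of size N^{1/p}
  -- R^{-1/q}.
  set R : ℝ := N / M ^ p with hRdef
  have hR : 0 < R := div_pos hN (Real.rpow_pos_of_pos hM _)
  set k1 : ℝ → ℝ≥0∞ := fun r => (Ioc 0 R).indicator (fun r => ENNReal.ofReal (r ^ (-(2 / q)))) r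
  set k2 : ℝ → ℝ≥0∞ := fun r => (Ioi R).indicator (fun r => ENNReal.ofReal (r ^ (-(2 / q)))) r
  have hk1 : Measurable k1 := Measurable.indicator (by fun_prop) measurableSet_Ioc
  have hk2 : Measurable k2 := Measurable.indicator (by fun_prop) measurableSet_Ioi
  have hk1' : Measurable fun t => k1 |t - s| := hk1.comp (by fun_prop)
  have hk2' : Measurable fun t => k2 |t - s| := hk2.comp (by fun_prop)
  have hsplit : ∫⁻ t in {t | a t ≤ ENNReal.ofReal M}, a t * rieszKernel q (t - s)
      ≤ ∫⁻ t, (ENNReal.ofReal M * k1 |t - s| + a t * k2 |t - s|) := by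
    refine (setLIntegral_mono' (measurableSet_le ha measurable_const) fun t ht => ?_).trans
      (setLIntegral_le_lintegral _ _)
    rcases eq_or_ne t s with rfl | hts
    -- On the diagonal `Real.rpow` gives 0 to a nonzero power the value 0, so nothing has to be
    -- bounded.
    · simp only [rieszKernel, sub_self, abs_zero, k1, k2]
      rw [Real.zero_rpow (by
        have : 0 < 2 / q := by positivity
        linarith)]
      simp
    have hpos : 0 < |t - s| := abs_pos.2 (sub_ne_zero.2 hts)
    by_cases hle : |t - s| ≤ R
    · refine le_add_right ?_
      rw [show k1 |t - s| = rieszKernel q (t - s) from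
        indicator_of_mem (show |t - s| ∈ Ioc 0 R from ⟨hpos, hle⟩) _]
      exact mul_le_mul_left ht _
    · refine le_add_left ?_
      rw [show k2 |t - s| = rieszKernel q (t - s) from
        indicator_of_mem (show |t - s| ∈ Ioi R from not_le.1 hle) _]
  have hnear : ∫⁻ t, ENNReal.ofReal M * k1 |t - s|
      = ENNReal.ofReal (2 / (1 - 2 / q) * N ^ (1 - 2 / q) * M ^ (p - 1)) := by
    rw [lintegral_const_mul _ hk1', lintegral_comp_abs_sub k1 hk1]
    simp only [k1]
    rw [setLIntegral_indicator measurableSet_Ioc,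
      inter_eq_left.2 (Ioc_subset_Ioi_self : Ioc (0 : ℝ) R ⊆ Ioi 0),
      setLIntegral_Ioc_rpow (by linarith) hR.le, show (2 : ℝ≥0∞) = ENNReal.ofReal 2 by simp,
      ← ENNReal.ofReal_mul (by norm_num), ← ENNReal.ofReal_mul hM.le]
    congr 1
    have e : R ^ (-(2 / q) + 1) = N ^ (1 - 2 / q) * M ^ (p - 1) / M := by
      rw [hRdef, Real.div_rpow hN.le (by positivity), ← Real.rpow_mul hM.le,
        show -(2 / q) + 1 = 1 - 2 / q by ring, mul_div_assoc, ← Real.rpow_sub_one hM.ne',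
        div_eq_mul_inv, ← Real.rpow_neg hM.le]
      congr 2
      have := hpq.inv_add_inv_eq_one
      field_simp at this ⊢
      nlinarith
    rw [e, show -(2 / q) + 1 = 1 - 2 / q by ring]
    field_simp
  have hfar : ∫⁻ t, a t * k2 |t - s|
      ≤ ENNReal.ofReal (2 ^ (1 / q) * N ^ (1 - 2 / q) * M ^ (p - 1)) := by
    refine (ENNReal.lintegral_mul_le_Lp_mul_Lq volume hpq ha.aemeasurable
      hk2'.aemeasurable).trans_eq ?_
    have e2 : ∫⁻ t, (k2 |t - s|) ^ q = ENNReal.ofReal (2 * R⁻¹) := by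
      rw [lintegral_comp_abs_sub (fun r => k2 r ^ q) (hk2.pow_const q)]
      have : ∀ r, k2 r ^ q = (Ioi R).indicator (fun r => ENNReal.ofReal (r ^ (-2 : ℝ))) r := by
        intro r
        by_cases hr : r ∈ Ioi R
        · have hr0 : 0 < r := hR.trans hr
          simp only [k2, indicator_of_mem hr]
          rw [ENNReal.ofReal_rpow_of_nonneg (Real.rpow_nonneg hr0.le _) hq0.le,
            ← Real.rpow_mul hr0.le]
          congr 2
          field_simp
        · simp [k2, indicator_of_notMem hr, hq0]
      simp only [this]
      rw [setLIntegral_indicator measurableSet_Ioi,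
        inter_eq_left.2 (Ioi_subset_Ioi hR.le),
        setLIntegral_Ioi_rpow (by norm_num) hR, show (2 : ℝ≥0∞) = ENNReal.ofReal 2 by simp,
        ← ENNReal.ofReal_mul (by norm_num)]
      norm_num [Real.rpow_neg_one]
    rw [haN, e2, ENNReal.ofReal_rpow_of_nonneg hN.le (by positivity),
      ENNReal.ofReal_rpow_of_nonneg (by positivity) (by positivity),
      ← ENNReal.ofReal_mul (by positivity)]
    congr 1
    rw [hRdef, inv_div, Real.mul_rpow (by norm_num) (by positivity),
      Real.div_rpow (by positivity) hN.le, ← Real.rpow_mul hM.le,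
      show p * (1 / q) = p - 1 by
        have := hpq.inv_add_inv_eq_one
        field_simp at this ⊢
        linarith,
      show 1 - 2 / q = 1 / p - 1 / q by
        have := hpq.inv_add_inv_eq_one
        rw [one_div, one_div]
        have h2 : 2 / q = 2 * q⁻¹ := by ring
        rw [h2]; linarith,
      Real.rpow_sub hN]
    ring
  refine hsplit.trans ?_
  rw [lintegral_add_left (by fun_prop), hnear]
  refine (add_le_add_right hfar _).trans_eq ?_
  rw [← ENNReal.ofReal_add (by
      have : 0 < 1 - 2 / q := by linarith
      positivity) (by positivity), hlsConst]
  congr 1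
  ring

/-- The symmetric Hardy–Littlewood–Sobolev inequality on the line. -/
lemma lintegral_mul_mul_rieszKernel_le {p q : ℝ} (hpq : p.HolderConjugate q) (hq : 2 < q)
    {a : ℝ → ℝ≥0∞} (ha : Measurable a) (hfin : ∫⁻ t, a t ^ p ≠ ∞) :
    ∫⁻ s, ∫⁻ t, a s * (a t * rieszKernel q (t - s))
      ≤ ENNReal.ofReal (2 * hlsConst q) * (∫⁻ t, a t ^ p) ^ (2 / p) := by
  have hp0 : 0 < p := hpq.pos
  have hq0 : 0 < q := by linarith
  have hγ : 0 < 1 - 2 / q := by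
    have : 2 / q < 1 := by rw [div_lt_one hq0]; exact hq
    linarith
  have hC : 0 ≤ hlsConst q := by unfold hlsConst; positivity
  obtain ⟨N, hN0, hN⟩ : ∃ N : ℝ, 0 ≤ N ∧ ∫⁻ t, a t ^ p = ENNReal.ofReal N :=
    ⟨_, ENNReal.toReal_nonneg, (ENNReal.ofReal_toReal hfin).symm⟩
  rcases hN0.eq_or_lt with rfl | hNpos
  · have h0 : ∀ᵐ t, a t = 0 := by
      rw [ENNReal.ofReal_zero, lintegral_eq_zero_iff (by fun_prop)] at hN
      filter_upwards [hN] with t ht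
      simpa [hp0, hp0.le, hp0.ne', not_lt.2 hp0.le] using ht
    have : ∫⁻ s, ∫⁻ t, a s * (a t * rieszKernel q (t - s)) = 0 := by
      rw [lintegral_eq_zero_iff']
      · filter_upwards [h0] with s hs
        simp [hs]
      · refine AEMeasurable.lintegral_prod_right'
          (f := fun z : ℝ × ℝ => a z.1 * (a z.2 * rieszKernel q (z.2 - z.1))) ?_
        have := measurable_rieszKernel q
        fun_prop
    rw [this]; exact zero_le
  have hkm := measurable_rieszKernel q
  -- By symmetry of the kernel it suffices to integrate over a t ≤ a s, at the cost of a factor 2.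
  -- There the sublevel bound applies with M = a s, and a s · (a s)^{p-1} integrates to N.
  set f : ℝ × ℝ → ℝ≥0∞ := fun z => {z : ℝ × ℝ | a z.2 ≤ a z.1}.indicator
    (fun z => a z.1 * (a z.2 * rieszKernel q (z.2 - z.1))) z with hf
  have hfm : Measurable f := by
    refine Measurable.indicator (by fun_prop) (measurableSet_le (by fun_prop) (by fun_prop))
  have hhalf : ∫⁻ s, ∫⁻ t, f (s, t)
      ≤ ENNReal.ofReal (hlsConst q * N ^ (1 - 2 / q)) * ∫⁻ s, a s ^ p := by
    rw [← lintegral_const_mul _ (by fun_prop)]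
    have hae : ∀ᵐ s, a s ^ p < ∞ := ae_lt_top (by fun_prop) hfin
    refine lintegral_mono_ae ?_
    filter_upwards [hae] with s hs
    have hs' : a s ≠ ∞ := by
      rintro h
      simp [h, hp0] at hs
    obtain ⟨M, hM0, hM⟩ : ∃ M : ℝ, 0 ≤ M ∧ a s = ENNReal.ofReal M :=
      ⟨_, ENNReal.toReal_nonneg, (ENNReal.ofReal_toReal hs').symm⟩
    rcases hM0.eq_or_lt with rfl | hMpos
    · have : ∀ t, f (s, t) = 0 := fun t => by
        simp only [hf, indicator]; split_ifs <;> simp [hM]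
      simp [this]
    have h1 : ∫⁻ t, f (s, t)
        = a s * ∫⁻ t in {t | a t ≤ ENNReal.ofReal M}, a t * rieszKernel q (t - s) := by
      rw [← lintegral_const_mul _ (by fun_prop),
        ← lintegral_indicator (measurableSet_le ha measurable_const)]
      refine lintegral_congr fun t => ?_
      simp only [hf, indicator, mem_ofPred_eq, hM]
    rw [h1]
    refine (mul_le_mul_right
      (setLIntegral_sublevel_mul_rieszKernel_le hpq hq ha hNpos hMpos hN s) _).trans_eq ?_
    rw [hM, ENNReal.ofReal_rpow_of_nonneg hM0 hp0.le, ← ENNReal.ofReal_mul hM0,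
      ← ENNReal.ofReal_mul (by positivity)]
    congr 1
    rw [Real.rpow_sub_one hMpos.ne']
    field_simp
  have hswap : ∫⁻ s, ∫⁻ t, f (t, s) = ∫⁻ s, ∫⁻ t, f (s, t) :=
    lintegral_lintegral_swap (f := fun s t => f (t, s)) (by fun_prop)
  calc ∫⁻ s, ∫⁻ t, a s * (a t * rieszKernel q (t - s))
      ≤ ∫⁻ s, ∫⁻ t, (f (s, t) + f (t, s)) := by
        refine lintegral_mono fun s => lintegral_mono fun t => ?_
        rcases le_total (a t) (a s) with h | h
        · refine le_add_right (le_of_eq ?_)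
          simp only [hf]
          rw [indicator_of_mem (show (s, t) ∈ {z : ℝ × ℝ | a z.2 ≤ a z.1} from h)]
        · refine le_add_left (le_of_eq ?_)
          simp only [hf]
          rw [indicator_of_mem (show (t, s) ∈ {z : ℝ × ℝ | a z.2 ≤ a z.1} from h)]
          rw [rieszKernel_sub_comm, mul_left_comm]
    _ = 2 * ∫⁻ s, ∫⁻ t, f (s, t) := by
        have e : ∀ s, ∫⁻ t, (f (s, t) + f (t, s)) = (∫⁻ t, f (s, t)) + ∫⁻ t, f (t, s) :=
          fun s => lintegral_add_left (by fun_prop) _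
        simp only [e]
        rw [lintegral_add_left (Measurable.lintegral_prod_right' hfm), hswap, two_mul]
    _ ≤ 2 * (ENNReal.ofReal (hlsConst q * N ^ (1 - 2 / q)) * ∫⁻ s, a s ^ p) := by gcongr
    _ = ENNReal.ofReal (2 * hlsConst q) * (∫⁻ t, a t ^ p) ^ (2 / p) := by
        rw [hN, ENNReal.ofReal_rpow_of_nonneg hN0 (by positivity),
          show (2 : ℝ≥0∞) = ENNReal.ofReal 2 by simp, ← ENNReal.ofReal_mul (by positivity),
          ← ENNReal.ofReal_mul (by positivity), ← ENNReal.ofReal_mul (by positivity)]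
        congr 1
        have e : 2 / p = 1 - 2 / q + 1 := by
          have := hpq.inv_add_inv_eq_one
          field_simp at this ⊢
          nlinarith
        rw [e, Real.rpow_add_one hNpos.ne']
        ring

/-! ### Interpolation between `L¹ → L^∞` and `L² → L²` -/

section Interpolation

variable {α : Type*} [MeasurableSpace α] {μ : Measure α}

/-- Above the height a, one has |f| = |f|^{1-p}|f|^p ≤ a^{1-p}|f|^p because 1 - p < 0. -/
lemma lintegral_enorm_indicator_le {p : ℝ} (hp : 1 < p) {f : α → ℂ} {a : ℝ} (ha : 0 < a) :
    ∫⁻ x, ‖{x | a < ‖f x‖}.indicator f x‖ₑ ∂μ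
      ≤ ENNReal.ofReal (a ^ (1 - p)) * ∫⁻ x, ‖f x‖ₑ ^ p ∂μ := by
  rw [← lintegral_const_mul' _ _ ENNReal.ofReal_ne_top]
  refine lintegral_mono fun x => ?_
  by_cases hx : a < ‖f x‖
  · rw [indicator_of_mem (show x ∈ {x | a < ‖f x‖} from hx), ← ofReal_norm,
      ENNReal.ofReal_rpow_of_nonneg (norm_nonneg _) (by linarith),
      ← ENNReal.ofReal_mul (by positivity)]
    refine ENNReal.ofReal_le_ofReal ?_
    have h0 : 0 < ‖f x‖ := ha.trans hx
    calc ‖f x‖ = ‖f x‖ ^ (1 - p) * ‖f x‖ ^ p := by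
          rw [← Real.rpow_add h0]; simp
      _ ≤ a ^ (1 - p) * ‖f x‖ ^ p := by
          gcongr ?_ * _
          exact Real.rpow_le_rpow_of_nonpos ha hx.le (by linarith)
  · simp [hx]

/-- The Marcinkiewicz splitting. The tall part of f is mapped below r/2 by the L¹ → L^∞ bound, so
wherever |T f| ≥ r the image of the low part is at least r/2; Chebyshev and the L² contraction then
bound the measure. -/
lemma meas_le_norm_apply_le {p q : ℝ} (hpq : p.HolderConjugate q)
    {T : Lp ℂ 2 μ → Lp ℂ 2 μ} (hadd : ∀ f g, T (f + g) = T f + T g) (hT : ∀ f, ‖T f‖ ≤ ‖f‖)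
    {A : ℝ} (hA : 0 < A)
    (hTA : ∀ f : Lp ℂ 2 μ, MemLp f 1 μ →
      ∀ᵐ x ∂μ, ‖T f x‖ₑ ≤ ENNReal.ofReal A * ∫⁻ y, ‖f y‖ₑ ∂μ)
    (f : Lp ℂ 2 μ) {N : ℝ} (hN : 0 < N) (hfN : ∫⁻ x, ‖f x‖ₑ ^ p ∂μ = ENNReal.ofReal N)
    {r : ℝ} (hr : 0 < r) :
    μ {x | r ≤ ‖T f x‖} ≤ ENNReal.ofReal (4 * r ^ (-2 : ℝ)) *
      ∫⁻ x in {x | ‖f x‖ ≤ (2 * A * N / r) ^ (q - 1)}, ‖f x‖ₑ ^ (2 : ℝ) ∂μ := by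
  -- The height solves A a^{1-p} N = r/2, using (q - 1)(p - 1) = 1.
  set a : ℝ := (2 * A * N / r) ^ (q - 1) with hadef
  have ha : 0 < a := by positivity
  have hfm : StronglyMeasurable f := Lp.stronglyMeasurable f
  have hS1 : MeasurableSet {x | a < ‖f x‖} := measurableSet_lt measurable_const hfm.norm.measurable
  have hS2 : MeasurableSet {x | ‖f x‖ ≤ a} := measurableSet_le hfm.norm.measurable measurable_const
  have hm1 : MemLp ({x | a < ‖f x‖}.indicator f) 2 μ := (Lp.memLp f).indicator hS1
  have hm2 : MemLp ({x | ‖f x‖ ≤ a}.indicator f) 2 μ := (Lp.memLp f).indicator hS2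
  set f1 : Lp ℂ 2 μ := hm1.toLp _
  set f2 : Lp ℂ 2 μ := hm2.toLp _
  have hsum : f = f1 + f2 := by
    refine Lp.ext ?_
    filter_upwards [Lp.coeFn_add f1 f2, hm1.coeFn_toLp, hm2.coeFn_toLp] with x h0 h1 h2
    rw [h0, Pi.add_apply, h1, h2]
    by_cases hx : a < ‖f x‖
    · simp [hx, not_le.2 hx]
    · simp [hx, not_lt.1 hx]
  have hf1 : ∫⁻ x, ‖f1 x‖ₑ ∂μ = ∫⁻ x, ‖{x | a < ‖f x‖}.indicator f x‖ₑ ∂μ :=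
    lintegral_congr_ae (hm1.coeFn_toLp.mono fun x hx => by simp only [f1]; rw [hx])
  have hle1 : ENNReal.ofReal A * ∫⁻ x, ‖f1 x‖ₑ ∂μ ≤ ENNReal.ofReal (r / 2) := by
    rw [hf1]
    refine (mul_le_mul_right (lintegral_enorm_indicator_le hpq.lt ha) _).trans_eq ?_
    rw [hfN, ← ENNReal.ofReal_mul (by positivity), ← ENNReal.ofReal_mul hA.le]
    congr 1
    rw [hadef, ← Real.rpow_mul (by positivity),
      show (q - 1) * (1 - p) = -1 by
        have := hpq.mul_eq_add
        nlinarith, Real.rpow_neg_one]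
    field_simp
  have hmem1 : MemLp f1 1 μ := by
    rw [memLp_one_iff_integrable]
    refine ⟨Lp.aestronglyMeasurable f1, ?_⟩
    rw [hasFiniteIntegral_iff_enorm]
    by_contra hcon
    rw [not_lt, top_le_iff] at hcon
    rw [hcon, ENNReal.mul_top (by simpa using hA)] at hle1
    exact ENNReal.ofReal_ne_top (top_le_iff.1 hle1)
  have hincl : ∀ᵐ x ∂μ, r ≤ ‖T f x‖ → ENNReal.ofReal (r / 2) ≤ ‖T f2 x‖ₑ := by
    filter_upwards [hTA f1 hmem1, Lp.coeFn_add (T f1) (T f2)] with x h1 h2 hx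
    have h3 : ‖T f1 x‖ ≤ r / 2 := by
      have := h1.trans hle1
      rwa [← ofReal_norm, ENNReal.ofReal_le_ofReal_iff (by positivity)] at this
    rw [← hadd, ← hsum] at h2
    rw [← ofReal_norm]
    refine ENNReal.ofReal_le_ofReal ?_
    rw [h2, Pi.add_apply] at hx
    linarith [norm_add_le (T f1 x) (T f2 x)]
  have hcheb := mul_meas_ge_le_pow_eLpNorm' μ (p := 2) (by norm_num) (by norm_num)
    (Lp.aestronglyMeasurable (T f2)) (ENNReal.ofReal (r / 2))
  have hnorm : eLpNorm (T f2) 2 μ ≤ eLpNorm f2 2 μ := by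
    have := hT f2
    rwa [Lp.norm_def, Lp.norm_def, ENNReal.toReal_le_toReal (Lp.eLpNorm_ne_top _)
      (Lp.eLpNorm_ne_top _)] at this
  have hf2 : eLpNorm f2 2 μ ^ (2 : ℝ≥0∞).toReal
      = ∫⁻ x in {x | ‖f x‖ ≤ a}, ‖f x‖ₑ ^ (2 : ℝ) ∂μ := by
    rw [eLpNorm_congr_ae hm2.coeFn_toLp,
      eLpNorm_eq_lintegral_rpow_enorm_toReal (by norm_num) (by norm_num), ← ENNReal.rpow_mul,
      ← lintegral_indicator hS2]
    simp only [ENNReal.toReal_ofNat]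
    rw [show (1 : ℝ) / 2 * 2 = 1 by norm_num, ENNReal.rpow_one]
    refine lintegral_congr fun x => ?_
    by_cases hx : ‖f x‖ ≤ a <;> simp [hx]
  have hmain : ENNReal.ofReal (r / 2) ^ (2 : ℝ) * μ {x | r ≤ ‖T f x‖}
      ≤ ∫⁻ x in {x | ‖f x‖ ≤ a}, ‖f x‖ₑ ^ (2 : ℝ) ∂μ := by
    rw [← hf2]
    refine le_trans ?_ (hcheb.trans (ENNReal.rpow_le_rpow hnorm (by norm_num)))
    rw [ENNReal.toReal_ofNat]
    exact mul_le_mul_right (measure_mono_ae hincl) _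
  have hinv : ENNReal.ofReal (4 * r ^ (-2 : ℝ)) * ENNReal.ofReal (r / 2) ^ (2 : ℝ) = 1 := by
    rw [ENNReal.ofReal_rpow_of_nonneg (by positivity) (by norm_num),
      ← ENNReal.ofReal_mul (by positivity), ← ENNReal.ofReal_one]
    congr 1
    rw [Real.div_rpow hr.le (by norm_num), Real.rpow_neg hr.le, Real.rpow_ofNat, Real.rpow_ofNat]
    field_simp
    norm_num
  calc μ {x | r ≤ ‖T f x‖}
      = ENNReal.ofReal (4 * r ^ (-2 : ℝ)) *
        (ENNReal.ofReal (r / 2) ^ (2 : ℝ) * μ {x | r ≤ ‖T f x‖}) := by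
        rw [← mul_assoc, hinv, one_mul]
    _ ≤ _ := by gcongr

/-- Layer cake and Tonelli: the level-set bound is integrated against t^{q-1} dt first in t for
fixed x. The resulting integral of t^{q-3} converges at 0 because q > 2. -/
lemma lintegral_enorm_apply_rpow_le [SFinite μ] {p q : ℝ} (hpq : p.HolderConjugate q) (hq : 2 < q)
    {T : Lp ℂ 2 μ → Lp ℂ 2 μ} (hadd : ∀ f g, T (f + g) = T f + T g) (hT : ∀ f, ‖T f‖ ≤ ‖f‖)
    {A : ℝ} (hA : 0 < A)
    (hTA : ∀ f : Lp ℂ 2 μ, MemLp f 1 μ →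
      ∀ᵐ x ∂μ, ‖T f x‖ₑ ≤ ENNReal.ofReal A * ∫⁻ y, ‖f y‖ₑ ∂μ)
    (f : Lp ℂ 2 μ) {N : ℝ} (hN : 0 < N) (hfN : ∫⁻ x, ‖f x‖ₑ ^ p ∂μ = ENNReal.ofReal N) :
    ∫⁻ x, ‖T f x‖ₑ ^ q ∂μ
      ≤ ENNReal.ofReal (4 * q * 2 ^ (q - 2) / (q - 2) * A ^ (q - 2) * N ^ (q - 1)) := by
  have hq0 : 0 < q := by linarith
  have hp0 : 0 < p := hpq.pos
  have hq2 : 0 < q - 2 := by linarith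
  have hfm : StronglyMeasurable f := Lp.stronglyMeasurable f
  set G : ℝ × α → ℝ≥0∞ := fun z =>
    {z : ℝ × α | ‖f z.2‖ ≤ (2 * A * N / z.1) ^ (q - 1)}.indicator
      (fun z => ENNReal.ofReal (4 * z.1 ^ (q - 3)) * ‖f z.2‖ₑ ^ (2 : ℝ)) z with hG
  have hfm2 : Measurable fun z : ℝ × α => f z.2 := hfm.measurable.comp measurable_snd
  have hGm : Measurable G := by
    refine Measurable.indicator (by fun_prop) (measurableSet_le (by fun_prop) (by fun_prop))
  have h1 : ∫⁻ x, ‖T f x‖ₑ ^ q ∂μ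
      = ENNReal.ofReal q * ∫⁻ t in Ioi 0, μ {x | t ≤ ‖T f x‖} * ENNReal.ofReal (t ^ (q - 1)) := by
    rw [← lintegral_rpow_eq_lintegral_meas_le_mul μ (Eventually.of_forall fun x => norm_nonneg _)
      (Lp.aestronglyMeasurable (T f)).norm.aemeasurable hq0]
    refine lintegral_congr fun x => ?_
    rw [← ofReal_norm, ENNReal.ofReal_rpow_of_nonneg (norm_nonneg _) hq0.le]
  have h2 : ∫⁻ t in Ioi 0, μ {x | t ≤ ‖T f x‖} * ENNReal.ofReal (t ^ (q - 1))
      ≤ ∫⁻ t in Ioi 0, ∫⁻ x, G (t, x) ∂μ := by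
    refine setLIntegral_mono' measurableSet_Ioi fun t ht => ?_
    have ht0 : 0 < t := ht
    have e : ∫⁻ x, G (t, x) ∂μ = ENNReal.ofReal (4 * t ^ (q - 3)) *
        ∫⁻ x in {x | ‖f x‖ ≤ (2 * A * N / t) ^ (q - 1)}, ‖f x‖ₑ ^ (2 : ℝ) ∂μ := by
      rw [← lintegral_const_mul _ (by have := hfm.measurable; fun_prop),
        ← lintegral_indicator (measurableSet_le hfm.norm.measurable measurable_const)]
      rfl
    rw [e]
    refine (mul_le_mul_left
      (meas_le_norm_apply_le hpq hadd hT hA hTA f hN hfN ht0) _).trans_eq ?_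
    rw [mul_right_comm, ← ENNReal.ofReal_mul (by positivity)]
    congr 2
    rw [mul_assoc, ← Real.rpow_add ht0]
    ring_nf
  have h3 : ∫⁻ t in Ioi 0, ∫⁻ x, G (t, x) ∂μ = ∫⁻ x, (∫⁻ t in Ioi 0, G (t, x)) ∂μ :=
    lintegral_lintegral_swap (f := fun t x => G (t, x)) hGm.aemeasurable
  have h4 : ∀ x, ∫⁻ t in Ioi 0, G (t, x)
      ≤ ENNReal.ofReal (4 * (2 * A * N) ^ (q - 2) / (q - 2)) * ‖f x‖ₑ ^ p := by
    intro x
    rcases eq_or_ne (f x) 0 with h0 | h0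
    · have : ∀ t, G (t, x) = 0 := fun t => by
        simp only [hG, indicator]; split_ifs <;> simp [h0]
      simp [this]
    have hpos : 0 < ‖f x‖ := norm_pos_iff.2 h0
    -- The truncation condition on f x, solved for t, reads t ≤ L.
    set L : ℝ := 2 * A * N * ‖f x‖ ^ (1 - p) with hL
    have hL0 : 0 < L := by positivity
    have hle : ∀ t ∈ Ioi (0 : ℝ), G (t, x) ≤ (Ioc 0 L).indicator
        (fun t => ENNReal.ofReal (4 * t ^ (q - 3)) * ‖f x‖ₑ ^ (2 : ℝ)) t := by
      intro t ht
      have ht0 : 0 < t := ht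
      by_cases hx : ‖f x‖ ≤ (2 * A * N / t) ^ (q - 1)
      · have htL : t ∈ Ioc 0 L := by
          refine ⟨ht, ?_⟩
          have h5 := Real.rpow_le_rpow hpos.le hx (z := p - 1) (by linarith [hpq.lt])
          rw [← Real.rpow_mul (by positivity), show (q - 1) * (p - 1) = 1 by
            have := hpq.mul_eq_add
            nlinarith, Real.rpow_one, le_div_iff₀ ht0] at h5
          rw [hL, show 1 - p = -(p - 1) by ring, Real.rpow_neg hpos.le, ← div_eq_mul_inv,
            le_div_iff₀ (by positivity), mul_comm]
          exact h5
        rw [indicator_of_mem htL]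
        simp only [hG]
        rw [indicator_of_mem
          (show (t, x) ∈ {z : ℝ × α | ‖f z.2‖ ≤ (2 * A * N / z.1) ^ (q - 1)} from hx)]
      · simp only [hG]
        rw [indicator_of_notMem
          (show (t, x) ∉ {z : ℝ × α | ‖f z.2‖ ≤ (2 * A * N / z.1) ^ (q - 1)} from hx)]
        exact zero_le
    refine (setLIntegral_mono' measurableSet_Ioi hle).trans_eq ?_
    rw [setLIntegral_indicator measurableSet_Ioc,
      inter_eq_left.2 (Ioc_subset_Ioi_self : Ioc (0 : ℝ) L ⊆ Ioi 0),
      lintegral_mul_const _ (by fun_prop)]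
    have e1 : ∀ t : ℝ, ENNReal.ofReal (4 * t ^ (q - 3))
        = ENNReal.ofReal 4 * ENNReal.ofReal (t ^ (q - 3)) :=
      fun t => ENNReal.ofReal_mul (by norm_num)
    simp only [e1]
    rw [lintegral_const_mul _ (by fun_prop), setLIntegral_Ioc_rpow (by linarith) hL0.le,
      ← ENNReal.ofReal_mul (by norm_num), ← ofReal_norm,
      ENNReal.ofReal_rpow_of_nonneg hpos.le (by norm_num),
      ENNReal.ofReal_rpow_of_nonneg hpos.le hp0.le, ← ENNReal.ofReal_mul (by
        rw [show q - 3 + 1 = q - 2 by ring]; positivity),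
      ← ENNReal.ofReal_mul (by positivity)]
    congr 1
    rw [show q - 3 + 1 = q - 2 by ring, hL, Real.mul_rpow (by positivity) (by positivity),
      ← Real.rpow_mul hpos.le]
    -- The exponents add up to p because pq = p + q.
    have e2 : ‖f x‖ ^ ((1 - p) * (q - 2)) * ‖f x‖ ^ (2 : ℝ) = ‖f x‖ ^ p := by
      rw [← Real.rpow_add hpos]
      congr 1
      have := hpq.mul_eq_add
      nlinarith
    rw [← e2]
    ring
  calc ∫⁻ x, ‖T f x‖ₑ ^ q ∂μ
      ≤ ENNReal.ofReal q * ∫⁻ x, ENNReal.ofReal (4 * (2 * A * N) ^ (q - 2) / (q - 2)) *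
          ‖f x‖ₑ ^ p ∂μ := by
        rw [h1]
        exact mul_le_mul_right (h2.trans (h3.trans_le (lintegral_mono h4))) _
    _ = _ := by
        rw [lintegral_const_mul' _ _ ENNReal.ofReal_ne_top, hfN,
          ← ENNReal.ofReal_mul (by positivity), ← ENNReal.ofReal_mul (by positivity)]
        congr 1
        rw [mul_assoc 2 A N, Real.mul_rpow (by norm_num) (by positivity),
          Real.mul_rpow hA.le hN.le, show q - 1 = q - 2 + 1 by ring, Real.rpow_add_one hN.ne']
        ring

/-- A contraction of `L²` which maps `L¹` to `L^∞` with norm `A` satisfies the interpolated bound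
from `L^p` to its dual. -/
lemma lintegral_enorm_apply_mul_enorm_le [SFinite μ] {p q : ℝ} (hpq : p.HolderConjugate q)
    (hq : 2 < q)
    {T : Lp ℂ 2 μ → Lp ℂ 2 μ} (hadd : ∀ f g, T (f + g) = T f + T g) (hT : ∀ f, ‖T f‖ ≤ ‖f‖)
    {A : ℝ} (hA : 0 < A)
    (hTA : ∀ f : Lp ℂ 2 μ, MemLp f 1 μ →
      ∀ᵐ x ∂μ, ‖T f x‖ₑ ≤ ENNReal.ofReal A * ∫⁻ y, ‖f y‖ₑ ∂μ)
    (f g : Lp ℂ 2 μ) (hfin : ∫⁻ x, ‖f x‖ₑ ^ p ∂μ ≠ ∞) :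
    ∫⁻ x, ‖T f x‖ₑ * ‖g x‖ₑ ∂μ
      ≤ ENNReal.ofReal ((4 * q * 2 ^ (q - 2) / (q - 2) * A ^ (q - 2)) ^ (1 / q)) *
        ((∫⁻ x, ‖f x‖ₑ ^ p ∂μ) ^ (1 / p) * (∫⁻ x, ‖g x‖ₑ ^ p ∂μ) ^ (1 / p)) := by
  have hq0 : 0 < q := by linarith
  have hq2 : 0 < q - 2 := by linarith
  have hp0 : 0 < p := hpq.pos
  obtain ⟨N, hN0, hN⟩ : ∃ N : ℝ, 0 ≤ N ∧ ∫⁻ x, ‖f x‖ₑ ^ p ∂μ = ENNReal.ofReal N :=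
    ⟨_, ENNReal.toReal_nonneg, (ENNReal.ofReal_toReal hfin).symm⟩
  rcases hN0.eq_or_lt with rfl | hNpos
  · have hf0 : f = 0 := by
      rw [ENNReal.ofReal_zero, lintegral_eq_zero_iff (by
        have := (Lp.stronglyMeasurable f).measurable
        fun_prop)] at hN
      refine Lp.ext ?_
      filter_upwards [hN, Lp.coeFn_zero ℂ 2 μ] with x hx h0
      rw [h0]
      simpa [hp0, hp0.le, hp0.ne', not_lt.2 hp0.le] using hx
    have hT0 : T f = 0 := by
      have := hT f
      rw [hf0, norm_zero] at this
      rw [hf0]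
      exact norm_le_zero_iff.1 this
    have : ∫⁻ x, ‖T f x‖ₑ * ‖g x‖ₑ ∂μ = 0 := by
      rw [hT0, ← lintegral_zero (μ := μ)]
      refine lintegral_congr_ae ?_
      filter_upwards [Lp.coeFn_zero ℂ 2 μ] with x h0
      rw [h0]
      simp
    rw [this]
    exact zero_le
  refine (ENNReal.lintegral_mul_le_Lp_mul_Lq μ hpq.symm
    (Lp.aestronglyMeasurable (T f)).enorm (Lp.aestronglyMeasurable g).enorm).trans ?_
  rw [← mul_assoc]
  refine mul_le_mul_left ?_ _
  refine (ENNReal.rpow_le_rpow (lintegral_enorm_apply_rpow_le hpq hq hadd hT hA hTA f hNpos hN)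
    (by positivity)).trans_eq ?_
  rw [hN, ENNReal.ofReal_rpow_of_nonneg (by positivity) (by positivity),
    ENNReal.ofReal_rpow_of_nonneg hN0 (by positivity), ← ENNReal.ofReal_mul (by positivity),
    Real.mul_rpow (by positivity) (by positivity), ← Real.rpow_mul hN0]
  congr 3
  have := hpq.mul_eq_add
  field_simp
  linarith

end Interpolation

end CriticalNLS

noncomputable section

namespace CriticalNLS

variable {n : ℕ}

/-! ### Chirps -/

/-- The quadratic phase `e^{i t |x|² / 2}`. -/
def chirp (t : ℝ) (x : Rn n) : ℂ := Complex.exp (Complex.I * ((t * ‖x‖ ^ 2 / 2 : ℝ) : ℂ))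

lemma norm_chirp (t : ℝ) (x : Rn n) : ‖chirp t x‖ = 1 := by
  rw [chirp, mul_comm, Complex.norm_exp_ofReal_mul_I]

lemma chirp_neg (t : ℝ) (x : Rn n) : chirp t (-x) = chirp t x := by simp [chirp]

lemma chirp_mul_chirp_neg (t : ℝ) (x : Rn n) : chirp t x * chirp (-t) x = 1 := by
  rw [chirp, chirp, ← Complex.exp_add, ← mul_add, ← Complex.ofReal_add]
  ring_nf
  simp

/-- The dilation by 2π converts Mathlib's frequency variable into that of the unitary normalization;
with it the flow becomes a chirp on the Fourier side. -/
lemma freeSymbol_eq_chirp (t : ℝ) (ξ : Rn n) : freeSymbol t ξ = chirp (-t) ((2 * Real.pi) • ξ) := by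
  rw [freeSymbol, chirp, norm_smul, ← mul_neg, ← Complex.ofReal_neg, Real.norm_eq_abs,
    mul_pow |2 * Real.pi|, sq_abs]
  congr 3
  ring

lemma norm_freeSymbol (t : ℝ) (ξ : Rn n) : ‖freeSymbol t ξ‖ = 1 := by
  rw [freeSymbol_eq_chirp, norm_chirp]

lemma freeSymbol_add (s t : ℝ) (ξ : Rn n) :
    freeSymbol (s + t) ξ = freeSymbol s ξ * freeSymbol t ξ := by
  rw [freeSymbol, freeSymbol, freeSymbol, ← Complex.exp_add, ← neg_add, ← mul_add,
    ← Complex.ofReal_add]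
  congr 4
  ring

lemma star_freeSymbol (t : ℝ) (ξ : Rn n) :
    (starRingEnd ℂ) (freeSymbol t ξ) = freeSymbol (-t) ξ := by
  rw [freeSymbol, freeSymbol, ← Complex.exp_conj]
  congr 1
  rw [map_neg, map_mul, Complex.conj_I, Complex.conj_ofReal]
  push_cast
  ring

lemma continuous_freeSymbol : Continuous fun z : ℝ × Rn n => freeSymbol z.1 z.2 := by
  unfold freeSymbol; fun_prop

lemma iteratedDeriv_cexp_I_mul (k : ℕ) :
    iteratedDeriv k (fun r : ℝ => Complex.exp (Complex.I * r))
      = fun r : ℝ => Complex.I ^ k * Complex.exp (Complex.I * r) := by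
  induction k with
  | zero => simp
  | succ k ih =>
    rw [iteratedDeriv_succ, ih]
    funext r
    have h : HasDerivAt (fun r : ℝ => Complex.I ^ k * Complex.exp (Complex.I * r))
        (Complex.I ^ k * (Complex.exp (Complex.I * r) * (Complex.I * 1))) r :=
      ((((hasDerivAt_id r).ofReal_comp).const_mul Complex.I).cexp).const_mul _
    rw [h.deriv, pow_succ]
    ring

lemma hasTemperateGrowth_cexp_I_mul :
    (fun r : ℝ => Complex.exp (Complex.I * r)).HasTemperateGrowth := by
  refine ⟨(contDiff_const.mul Complex.ofRealCLM.contDiff).cexp, fun k => ⟨0, 1, fun r => ?_⟩⟩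
  rw [norm_iteratedFDeriv_eq_norm_iteratedDeriv, iteratedDeriv_cexp_I_mul]
  simp [mul_comm Complex.I, Complex.norm_exp_ofReal_mul_I]

lemma hasTemperateGrowth_chirp (t : ℝ) : (chirp t : Rn n → ℂ).HasTemperateGrowth := by
  have h : (fun x : Rn n => t / 2 * ‖x‖ ^ 2).HasTemperateGrowth :=
    (Function.HasTemperateGrowth.const _).mul (Function.hasTemperateGrowth_norm_sq (H := Rn n))
  convert hasTemperateGrowth_cexp_I_mul.comp h using 1
  funext x
  simp only [chirp, Function.comp]
  congr 3
  ring

lemma hasTemperateGrowth_freeSymbol (t : ℝ) : (freeSymbol t : Rn n → ℂ).HasTemperateGrowth := by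
  have h : (fun x : Rn n => -(t / 2 * (2 * Real.pi) ^ 2) * ‖x‖ ^ 2).HasTemperateGrowth :=
    (Function.HasTemperateGrowth.const _).mul (Function.hasTemperateGrowth_norm_sq (H := Rn n))
  convert hasTemperateGrowth_cexp_I_mul.comp h using 1
  funext x
  simp only [freeSymbol, Function.comp]
  congr 1
  push_cast
  ring

/-! ### The free flow on Schwartz functions -/

/-- `U₀(t) = e^{i t Δ / 2}` on Schwartz functions. -/
@[irreducible] def freeSchwartz (t : ℝ) : 𝓢(Rn n, ℂ) →L[ℂ] 𝓢(Rn n, ℂ) :=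
  SchwartzMap.fourierMultiplierCLM ℂ (freeSymbol t)

lemma fourier_freeSchwartz (t : ℝ) (f : 𝓢(Rn n, ℂ)) (ξ : Rn n) :
    𝓕 (freeSchwartz t f) ξ = freeSymbol t ξ * 𝓕 f ξ := by
  rw [freeSchwartz, SchwartzMap.fourierMultiplierCLM_apply, FourierTransform.fourier_fourierInv_eq,
    SchwartzMap.smulLeftCLM_apply_apply (hasTemperateGrowth_freeSymbol t), smul_eq_mul]

lemma freeSchwartz_apply (t : ℝ) (f : 𝓢(Rn n, ℂ)) (x : Rn n) :
    freeSchwartz t f x = ∫ ξ, Complex.exp (((2 * Real.pi * inner ℝ ξ x : ℝ) : ℂ) * Complex.I) *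
      (freeSymbol t ξ * 𝓕 f ξ) := by
  rw [freeSchwartz, SchwartzMap.fourierMultiplierCLM_apply, SchwartzMap.fourierInv_coe,
    Real.fourierInv_eq']
  simp only [smul_eq_mul, SchwartzMap.smulLeftCLM_apply_apply (hasTemperateGrowth_freeSymbol t)]

/-- The multiplier on distributions acts on test functions with 𝓕 and 𝓕⁻ in the opposite order. The
order is immaterial since the symbol is even. -/
lemma fourier_freeSymbol_fourierInv (t : ℝ) (u : 𝓢(Rn n, ℂ)) :
    𝓕 (SchwartzMap.smulLeftCLM ℂ (freeSymbol t) (𝓕⁻ u)) = freeSchwartz t u := by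
  ext x
  rw [freeSchwartz, SchwartzMap.fourierMultiplierCLM_apply, SchwartzMap.fourierInv_coe,
    Real.fourierInv_eq_fourier_comp_neg, SchwartzMap.fourier_coe]
  refine congrFun (congrArg _ ?_) x
  funext ξ
  rw [SchwartzMap.smulLeftCLM_apply_apply (hasTemperateGrowth_freeSymbol t),
    SchwartzMap.smulLeftCLM_apply_apply (hasTemperateGrowth_freeSymbol t),
    SchwartzMap.fourierInv_coe, Real.fourierInv_eq_fourier_neg, ← SchwartzMap.fourier_coe]
  simp [freeSymbol]

/-! ### The Fourier transform in the unitary normalization, on Schwartz functions -/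

lemma fourierSchwartz_apply (f : 𝓢(Rn n, ℂ)) (x : Rn n) :
    fourierSchwartz n f x = fourierConst n * 𝓕 f ((2 * Real.pi)⁻¹ • x) := rfl

lemma fourier_fourier_apply (f : 𝓢(Rn n, ℂ)) (x : Rn n) : 𝓕 (𝓕 f) x = f (-x) := by
  have h : 𝓕⁻ (𝓕 f) (-x) = f (-x) := by rw [FourierTransform.fourierInv_fourier_eq]
  rw [← h, SchwartzMap.fourierInv_coe, Real.fourierInv_eq_fourier_neg, neg_neg,
    SchwartzMap.fourier_coe]

lemma fourier_fourierSchwartz (f : 𝓢(Rn n, ℂ)) (ξ : Rn n) :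
    𝓕 (fourierSchwartz n f) ξ
      = fourierConst n * ((2 * Real.pi) ^ n : ℝ) * f (-((2 * Real.pi) • ξ)) := by
  have hπ : (2 * Real.pi : ℝ) ≠ 0 := by positivity
  rw [← fourier_fourier_apply, SchwartzMap.fourier_coe, SchwartzMap.fourier_coe (𝓕 f),
    Real.fourier_eq', Real.fourier_eq']
  have h := Measure.integral_comp_smul (volume : Measure (Rn n))
    (fun v => Complex.exp (((-2 * Real.pi * inner ℝ v ((2 * Real.pi) • ξ) : ℝ) : ℂ) * Complex.I) •
      𝓕 f v) ((2 * Real.pi)⁻¹)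
  have e : |(((2 * Real.pi)⁻¹ : ℝ) ^ Module.finrank ℝ (Rn n))⁻¹| = (2 * Real.pi) ^ n := by
    rw [finrank_euclideanSpace_fin, inv_pow, inv_inv, abs_of_pos (by positivity)]
  rw [e] at h
  rw [Complex.real_smul] at h
  rw [mul_assoc, ← h, ← integral_const_mul]
  congr 1
  funext v
  rw [fourierSchwartz_apply, inner_smul_left, inner_smul_right]
  simp only [smul_eq_mul, conj_trivial]
  rw [inv_mul_cancel_left₀ hπ]
  ring

lemma fourierConst_mul_self : fourierConst n * (fourierConst n * ((2 * Real.pi) ^ n : ℝ)) = 1 := by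
  rw [fourierConst, ← Complex.ofReal_mul, ← Complex.ofReal_mul, ← Complex.ofReal_one]
  congr 1
  have h : 0 < 2 * Real.pi := by positivity
  rw [← Real.rpow_natCast, ← Real.rpow_add h, ← Real.rpow_add h]
  ring_nf
  simp

lemma fourierSchwartz_fourierSchwartz (f : 𝓢(Rn n, ℂ)) (x : Rn n) :
    fourierSchwartz n (fourierSchwartz n f) x = f (-x) := by
  have hπ : (2 * Real.pi : ℝ) ≠ 0 := by positivity
  rw [fourierSchwartz_apply, fourier_fourierSchwartz, smul_inv_smul₀ hπ, ← mul_assoc,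
    fourierConst_mul_self, one_mul]

/-- The Fourier transform intertwines multiplication by a chirp with the free flow. -/
lemma fourierSchwartz_chirp (t : ℝ) (f : 𝓢(Rn n, ℂ)) :
    fourierSchwartz n (SchwartzMap.smulLeftCLM ℂ (chirp t) f)
      = freeSchwartz (-t) (fourierSchwartz n f) := by
  refine (FourierTransform.fourierCLE ℂ 𝓢(Rn n, ℂ)).injective ?_
  ext ξ
  rw [FourierTransform.fourierCLE_apply, FourierTransform.fourierCLE_apply]
  rw [fourier_freeSchwartz, fourier_fourierSchwartz, fourier_fourierSchwartz,
    SchwartzMap.smulLeftCLM_apply_apply (hasTemperateGrowth_chirp t), freeSymbol_eq_chirp, neg_neg,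
    chirp_neg, smul_eq_mul]
  ring

/-! ### Joint continuity -/

lemma continuous_freeSchwartz_uncurry (f : 𝓢(Rn n, ℂ)) :
    Continuous fun z : ℝ × Rn n => freeSchwartz z.1 f z.2 := by
  simp only [freeSchwartz_apply]
  refine continuous_of_dominated (bound := fun ξ => ‖𝓕 f ξ‖) ?_ ?_ ?_ ?_
  · intro z
    refine Continuous.aestronglyMeasurable ?_
    have h1 : Continuous fun ξ => 𝓕 f ξ := (𝓕 f).continuous
    have h2 : Continuous fun ξ : Rn n => freeSymbol z.1 ξ :=
      continuous_freeSymbol.comp (by fun_prop : Continuous fun ξ : Rn n => (z.1, ξ))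
    fun_prop
  · intro z
    refine Eventually.of_forall fun ξ => le_of_eq ?_
    rw [norm_mul, norm_mul, norm_freeSymbol, Complex.norm_exp_ofReal_mul_I, one_mul, one_mul]
  · exact (𝓕 f).integrable.norm
  · refine Eventually.of_forall fun ξ => ?_
    have h2 : Continuous fun z : ℝ × Rn n => freeSymbol z.1 ξ :=
      continuous_freeSymbol.comp (by fun_prop : Continuous fun z : ℝ × Rn n => (z.1, ξ))
    fun_prop

lemma norm_freeSchwartz_apply_le (t : ℝ) (f : 𝓢(Rn n, ℂ)) (x : Rn n) :
    ‖freeSchwartz t f x‖ ≤ ∫ ξ, ‖𝓕 f ξ‖ := by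
  rw [freeSchwartz_apply]
  refine (norm_integral_le_integral_norm _).trans_eq ?_
  congr 1
  funext ξ
  rw [norm_mul, norm_mul, norm_freeSymbol, Complex.norm_exp_ofReal_mul_I, one_mul, one_mul]

/-! ### The kernel of the free flow -/

/-- The constant `(2π i t)^{-n/2}` of the kernel of the free flow. -/
def kernelConst (n : ℕ) (t : ℝ) : ℂ :=
  (Real.pi / (2 * Real.pi ^ 2 * t * Complex.I)) ^ ((n : ℂ) / 2)

/-- The base of the complex power is a nonzero multiple of i, hence off the branch cut. Conjugation
and continuity of the power both depend on this. -/
lemma kernel_base_eq {t : ℝ} (ht : t ≠ 0) :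
    (Real.pi / (2 * Real.pi ^ 2 * t * Complex.I) : ℂ)
      = ((-(1 / (2 * Real.pi * t)) : ℝ) : ℂ) * Complex.I := by
  have hπ : (Real.pi : ℂ) ≠ 0 := by exact_mod_cast Real.pi_ne_zero
  have ht' : (t : ℂ) ≠ 0 := by exact_mod_cast ht
  have hI := Complex.I_ne_zero
  push_cast
  field_simp
  rw [Complex.I_sq]
  ring

lemma norm_kernelConst {t : ℝ} (ht : t ≠ 0) :
    ‖kernelConst n t‖ = (2 * Real.pi * |t|) ^ (-(n : ℝ) / 2) := by
  have h : ((n : ℂ) / 2) = (((n : ℝ) / 2 : ℝ) : ℂ) := by push_cast; ring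
  have hb : 0 < 2 * Real.pi * |t| := by positivity
  rw [kernelConst, kernel_base_eq ht, h, Complex.norm_cpow_real, norm_mul, Complex.norm_I, mul_one,
    Complex.norm_real, norm_neg, Real.norm_eq_abs, abs_div, abs_one, abs_mul,
    abs_of_pos (by positivity : 0 < 2 * Real.pi), one_div, Real.inv_rpow hb.le,
    ← Real.rpow_neg hb.le]
  ring_nf

lemma kernelConst_neg {t : ℝ} (ht : t ≠ 0) :
    kernelConst n (-t) = (starRingEnd ℂ) (kernelConst n t) := by
  have h : ((n : ℂ) / 2) = (starRingEnd ℂ) ((n : ℂ) / 2) := by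
    rw [show (n : ℂ) / 2 = (((n : ℝ) / 2 : ℝ) : ℂ) by push_cast; ring, Complex.conj_ofReal]
  rw [kernelConst, kernelConst, kernel_base_eq ht, kernel_base_eq (neg_ne_zero.2 ht), h,
    ← Complex.conj_cpow]
  · conv_lhs => rw [← h]
    congr 1
    rw [map_mul, Complex.conj_I, Complex.conj_ofReal]
    push_cast
    ring
  · intro harg
    rw [Complex.arg_eq_pi_iff] at harg
    simp at harg

lemma kernelConst_mul_neg {t : ℝ} (ht : t ≠ 0) :
    kernelConst n t * kernelConst n (-t) = (((2 * Real.pi * |t|) ^ (-(n : ℝ)) : ℝ) : ℂ) := by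
  have hb : 0 < 2 * Real.pi * |t| := by positivity
  rw [kernelConst_neg ht, Complex.mul_conj, Complex.normSq_eq_norm_sq, norm_kernelConst ht,
    ← Real.rpow_natCast, ← Real.rpow_mul hb.le]
  congr 2
  push_cast
  ring

/-- The regularized free flow is convolution with a Gaussian. -/
lemma integral_gaussian_mul_fourier {b : ℂ} (hb : 0 < b.re) (f : 𝓢(Rn n, ℂ)) (x : Rn n) :
    ∫ ξ, Complex.exp (-b * ‖ξ‖ ^ 2 + 2 * Real.pi * Complex.I * (inner ℝ x ξ : ℝ)) * 𝓕 f ξ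
      = (Real.pi / b) ^ ((n : ℂ) / 2) *
        ∫ y, Complex.exp (-Real.pi ^ 2 * ‖x - y‖ ^ 2 / b) * f y := by
  have hg : Integrable (fun ξ : Rn n =>
      Complex.exp (-b * ‖ξ‖ ^ 2 + 2 * Real.pi * Complex.I * (inner ℝ x ξ : ℝ))) :=
    GaussianFourier.integrable_cexp_neg_mul_sq_norm_add hb _ x
  have h := VectorFourier.integral_fourierIntegral_smul_eq_flip (L := innerₗ (Rn n))
    Real.continuous_fourierChar continuous_inner hg f.integrable (μ := volume) (ν := volume)
  have h' : ∫ ξ, 𝓕 (fun ξ : Rn n =>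
      Complex.exp (-b * ‖ξ‖ ^ 2 + 2 * Real.pi * Complex.I * (inner ℝ x ξ : ℝ))) ξ * f ξ
      = ∫ ξ, Complex.exp (-b * ‖ξ‖ ^ 2 + 2 * Real.pi * Complex.I * (inner ℝ x ξ : ℝ)) * 𝓕 f ξ := by
    simpa using! h
  rw [← h', ← integral_const_mul]
  congr 1
  funext y
  rw [fourier_gaussian_innerProductSpace' hb, finrank_euclideanSpace_fin, mul_assoc]

lemma norm_exp_neg_sq_div_le {b : ℂ} (hb : 0 ≤ b.re) (r : ℝ) :
    ‖Complex.exp (-Real.pi ^ 2 * (r : ℂ) ^ 2 / b)‖ ≤ 1 := by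
  rw [Complex.norm_exp, Real.exp_le_one_iff,
    show (-Real.pi ^ 2 * (r : ℂ) ^ 2 / b : ℂ) = ((-(Real.pi ^ 2 * r ^ 2) : ℝ) : ℂ) * b⁻¹ by
      push_cast; ring, Complex.re_ofReal_mul, Complex.inv_re]
  have : 0 ≤ b.re / Complex.normSq b := div_nonneg hb (Complex.normSq_nonneg _)
  nlinarith [mul_nonneg (mul_nonneg (sq_nonneg Real.pi) (sq_nonneg r)) this]

/-- The free flow is an integral operator with an oscillatory Gaussian kernel. -/
lemma freeSchwartz_eq_integral_kernel {t : ℝ} (ht : t ≠ 0) (f : 𝓢(Rn n, ℂ)) (x : Rn n) :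
    freeSchwartz t f x = kernelConst n t * ∫ y, chirp (1 / t) (x - y) * f y := by
  -- Adding ε > 0 makes the oscillatory Gaussian integrable. As ε → 0⁺ both sides converge by
  -- dominated convergence, with majorants |𝓕 f| in frequency and |f| in space.
  set b : ℝ → ℂ := fun ε => ε + 2 * Real.pi ^ 2 * t * Complex.I with hbdef
  have hbcont : Continuous b := by fun_prop
  have hre : ∀ ε, (b ε).re = ε := by
    intro ε
    have e : b ε = (ε : ℂ) + ((2 * Real.pi ^ 2 * t : ℝ) : ℂ) * Complex.I := by
      simp only [hbdef]; push_cast; ring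
    rw [e, Complex.add_re, Complex.re_ofReal_mul, Complex.I_re, Complex.ofReal_re, mul_zero,
      add_zero]
  have hb0 : b 0 = 2 * Real.pi ^ 2 * t * Complex.I := by simp [hbdef]
  have hπ : (Real.pi : ℂ) ≠ 0 := by exact_mod_cast Real.pi_ne_zero
  have ht' : (t : ℂ) ≠ 0 := by exact_mod_cast ht
  have hb0ne : b 0 ≠ 0 := by
    rw [hb0]
    simp [hπ, ht']
  have hpos : ∀ᶠ ε in 𝓝[>] (0 : ℝ), 0 < ε := self_mem_nhdsWithin
  have hfc : Continuous fun y => f y := f.continuous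
  have hFc : Continuous fun y => 𝓕 f y := (𝓕 f).continuous
  have hleft : Tendsto (fun ε => ∫ ξ, Complex.exp (-b ε * ‖ξ‖ ^ 2 +
      2 * Real.pi * Complex.I * (inner ℝ x ξ : ℝ)) * 𝓕 f ξ) (𝓝[>] 0) (𝓝 (freeSchwartz t f x)) := by
    have e : freeSchwartz t f x = ∫ ξ, Complex.exp (-b 0 * ‖ξ‖ ^ 2 +
        2 * Real.pi * Complex.I * (inner ℝ x ξ : ℝ)) * 𝓕 f ξ := by
      rw [freeSchwartz_apply]
      congr 1
      funext ξ
      rw [← mul_assoc, freeSymbol, ← Complex.exp_add, hb0, real_inner_comm]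
      congr 2
      push_cast
      ring
    rw [e]
    refine tendsto_integral_filter_of_dominated_convergence (fun ξ => ‖𝓕 f ξ‖) ?_ ?_
      (𝓕 f).integrable.norm ?_
    · exact Eventually.of_forall fun ε => Continuous.aestronglyMeasurable (by fun_prop)
    · filter_upwards [hpos] with ε hε
      refine Eventually.of_forall fun ξ => ?_
      rw [norm_mul]
      refine mul_le_of_le_one_left (norm_nonneg _) ?_
      rw [Complex.norm_exp, Real.exp_le_one_iff,
        show (-b ε * (‖ξ‖ : ℂ) ^ 2 + 2 * Real.pi * Complex.I * (inner ℝ x ξ : ℝ) : ℂ)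
          = -(((‖ξ‖ ^ 2 : ℝ) : ℂ) * b ε) + ((2 * Real.pi * inner ℝ x ξ : ℝ) : ℂ) * Complex.I by
          push_cast; ring, Complex.add_re, Complex.neg_re, Complex.re_ofReal_mul, hre,
          Complex.re_ofReal_mul, Complex.I_re]
      nlinarith [mul_nonneg (sq_nonneg ‖ξ‖) hε.le]
    · refine Eventually.of_forall fun ξ => ?_
      refine Tendsto.mono_left ?_ nhdsWithin_le_nhds
      exact Continuous.tendsto (by fun_prop) 0
  have hright : Tendsto (fun ε => (Real.pi / b ε) ^ ((n : ℂ) / 2) *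
      ∫ y, Complex.exp (-Real.pi ^ 2 * ‖x - y‖ ^ 2 / b ε) * f y) (𝓝[>] 0)
      (𝓝 (kernelConst n t * ∫ y, chirp (1 / t) (x - y) * f y)) := by
    refine Tendsto.mul ?_ ?_
    · rw [kernelConst, ← hb0]
      have hc : ContinuousAt (fun ε => (Real.pi / b ε : ℂ) ^ ((n : ℂ) / 2)) 0 := by
        refine ContinuousAt.cpow (continuousAt_const.div hbcont.continuousAt hb0ne)
          continuousAt_const ?_
        rw [hb0, kernel_base_eq ht, Complex.mem_slitPlane_iff]
        right
        simp [ht, Real.pi_ne_zero]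
      exact hc.tendsto.mono_left nhdsWithin_le_nhds
    · refine tendsto_integral_filter_of_dominated_convergence (fun y => ‖f y‖) ?_ ?_
        f.integrable.norm ?_
      · exact Eventually.of_forall fun ε => Continuous.aestronglyMeasurable (by fun_prop)
      · filter_upwards [hpos] with ε hε
        refine Eventually.of_forall fun y => ?_
        rw [norm_mul]
        exact mul_le_of_le_one_left (norm_nonneg _)
          (norm_exp_neg_sq_div_le (by rw [hre]; exact hε.le) _)
      · refine Eventually.of_forall fun y => ?_
        have e : chirp (1 / t) (x - y) = Complex.exp (-Real.pi ^ 2 * ‖x - y‖ ^ 2 / b 0) := by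
          rw [chirp, hb0]
          congr 1
          push_cast
          have hI := Complex.I_ne_zero
          field_simp
          rw [Complex.I_sq]
          ring
        rw [e]
        have hc : ContinuousAt
            (fun ε => Complex.exp (-Real.pi ^ 2 * (‖x - y‖ : ℂ) ^ 2 / b ε) * f y) 0 :=
          ((continuousAt_const.div hbcont.continuousAt hb0ne).cexp).mul continuousAt_const
        exact hc.tendsto.mono_left nhdsWithin_le_nhds
  refine tendsto_nhds_unique hleft (hright.congr' ?_)
  filter_upwards [hpos] with ε hε
  exact (integral_gaussian_mul_fourier (by rw [hre]; exact hε) f x).symm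

/-! ### The pseudoconformal transformation -/

lemma inv_fourierConst : fourierConst n * (((2 * Real.pi) ^ ((n : ℝ) / 2) : ℝ) : ℂ) = 1 := by
  rw [fourierConst, ← Complex.ofReal_mul, ← Real.rpow_add (by positivity), neg_div,
    neg_add_cancel, Real.rpow_zero, Complex.ofReal_one]

/-- The constant `(i t)^{-n/2}` of the pseudoconformal transformation. -/
def conformalConst (n : ℕ) (t : ℝ) : ℂ :=
  kernelConst n t * (((2 * Real.pi) ^ ((n : ℝ) / 2) : ℝ) : ℂ)

lemma norm_conformalConst {t : ℝ} (ht : t ≠ 0) :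
    ‖conformalConst n t‖ = |t| ^ (-(n : ℝ) / 2) := by
  have h : 0 < 2 * Real.pi := by positivity
  rw [conformalConst, norm_mul, norm_kernelConst ht, Complex.norm_real,
    Real.norm_of_nonneg (by positivity), Real.mul_rpow h.le (abs_nonneg _), mul_right_comm,
    ← Real.rpow_add h, neg_div, neg_add_cancel, Real.rpow_zero, one_mul]

lemma conformalConst_mul_neg {t : ℝ} (ht : t ≠ 0) :
    conformalConst n t * conformalConst n (-t) = ((|t| ^ (-(n : ℝ)) : ℝ) : ℂ) := by
  have h : 0 < 2 * Real.pi := by positivity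
  rw [conformalConst, conformalConst, mul_mul_mul_comm, kernelConst_mul_neg ht,
    ← Complex.ofReal_mul, ← Complex.ofReal_mul, Real.mul_rpow h.le (abs_nonneg _), mul_right_comm,
    ← Real.rpow_add h, ← Real.rpow_add h]
  ring_nf
  simp

/-- The pseudoconformal transformation: the flow at time `t` of `f` is a modulated and rescaled
flow at time `-1/t` of the Fourier transform of `f`. -/
lemma freeSchwartz_eq_conformal {t : ℝ} (ht : t ≠ 0) (f : 𝓢(Rn n, ℂ)) (x : Rn n) :
    freeSchwartz t f x = conformalConst n t * chirp (1 / t) x *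
      freeSchwartz (-(1 / t)) (fourierSchwartz n f) (t⁻¹ • x) := by
  rw [freeSchwartz_eq_integral_kernel ht, ← fourierSchwartz_chirp, fourierSchwartz_apply,
    SchwartzMap.fourier_coe, Real.fourier_eq', conformalConst]
  -- Expanding |x - y|² factors the kernel into a chirp in x, a chirp in y and e^{-i x·y/t}; the
  -- integral is thus a Fourier transform at x/t.
  have e : ∫ y, chirp (1 / t) (x - y) * f y = chirp (1 / t) x *
      ∫ v, Complex.exp (((-2 * Real.pi * inner ℝ v ((2 * Real.pi)⁻¹ • t⁻¹ • x) : ℝ) : ℂ) *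
        Complex.I) • SchwartzMap.smulLeftCLM ℂ (chirp (1 / t)) f v := by
    rw [← integral_const_mul]
    congr 1
    funext y
    rw [SchwartzMap.smulLeftCLM_apply_apply (hasTemperateGrowth_chirp _), smul_eq_mul, smul_eq_mul,
      ← mul_assoc, ← mul_assoc]
    congr 1
    rw [chirp, chirp, chirp, ← Complex.exp_add, ← Complex.exp_add]
    congr 1
    rw [norm_sub_sq_real, inner_smul_right, inner_smul_right, real_inner_comm]
    have hπ : (Real.pi : ℂ) ≠ 0 := by exact_mod_cast Real.pi_ne_zero
    have ht' : (t : ℂ) ≠ 0 := by exact_mod_cast ht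
    push_cast
    field_simp
    ring
  rw [e]
  have := inv_fourierConst (n := n)
  linear_combination (-1 : ℂ) * (kernelConst n t * chirp (1 / t) x *
    ∫ v, Complex.exp (((-2 * Real.pi * inner ℝ v ((2 * Real.pi)⁻¹ • t⁻¹ • x) : ℝ) : ℂ) *
        Complex.I) • SchwartzMap.smulLeftCLM ℂ (chirp (1 / t)) f v) * this

/-! ### Continuity of families in `L²` -/

lemma norm_sq_eq_integral {α : Type*} [MeasurableSpace α] {μ : Measure α} (f : Lp ℂ 2 μ) :
    ‖f‖ ^ 2 = ∫ x, ‖f x‖ ^ 2 ∂μ := by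
  have h := inner_self_eq_norm_sq_to_K (𝕜 := ℂ) f
  rw [L2.inner_def] at h
  have h2 : ∀ x, inner ℂ (f x) (f x) = ((‖f x‖ ^ 2 : ℝ) : ℂ) := fun x => by
    rw [inner_self_eq_norm_sq_to_K]; push_cast; rfl
  simp only [h2] at h
  rw [integral_complex_ofReal] at h
  have h3 : ((∫ x, ‖f x‖ ^ 2 ∂μ : ℝ) : ℂ) = ((‖f‖ ^ 2 : ℝ) : ℂ) := by
    rw [h]; push_cast; rfl
  exact (Complex.ofReal_injective h3).symm

/-- Dominated convergence for the squared L² distance. It supplies the continuity in time that makes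
the L²-valued integrals below meaningful. -/
lemma continuous_toLp_of_dominated {X α : Type*} [TopologicalSpace X] [FirstCountableTopology X]
    [MeasurableSpace α] {μ : Measure α} {F : X → α → ℂ} (hF : ∀ z, MemLp (F z) 2 μ) {g : α → ℝ}
    (hg : MemLp g 2 μ) (hbound : ∀ z, ∀ᵐ x ∂μ, ‖F z x‖ ≤ g x)
    (hcont : ∀ᵐ x ∂μ, Continuous fun z => F z x) :
    Continuous fun z => (hF z).toLp (F z) := by
  rw [continuous_iff_continuousAt]
  intro z₀
  rw [ContinuousAt, tendsto_iff_norm_sub_tendsto_zero]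
  have hsq : Tendsto (fun z => ‖(hF z).toLp (F z) - (hF z₀).toLp (F z₀)‖ ^ 2) (𝓝 z₀) (𝓝 0) := by
    have e : ∀ z, ‖(hF z).toLp (F z) - (hF z₀).toLp (F z₀)‖ ^ 2
        = ∫ x, ‖F z x - F z₀ x‖ ^ 2 ∂μ := by
      intro z
      rw [← MemLp.toLp_sub, norm_sq_eq_integral]
      refine integral_congr_ae ?_
      filter_upwards [((hF z).sub (hF z₀)).coeFn_toLp] with x hx
      rw [hx, Pi.sub_apply]
    simp only [e]
    have h0 : (0 : ℝ) = ∫ x, ‖F z₀ x - F z₀ x‖ ^ 2 ∂μ := by simp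
    rw [h0]
    refine tendsto_integral_filter_of_dominated_convergence (fun x => (2 * g x) ^ 2) ?_ ?_ ?_ ?_
    · exact Eventually.of_forall fun z =>
        (((hF z).1.sub (hF z₀).1).norm.pow 2)
    · refine Eventually.of_forall fun z => ?_
      filter_upwards [hbound z, hbound z₀] with x h1 h2
      rw [norm_pow, norm_norm]
      gcongr
      exact (norm_sub_le _ _).trans (by linarith)
    · have := (hg.const_mul 2).integrable_sq
      exact this
    · filter_upwards [hcont] with x hx
      exact (((hx.sub continuous_const).norm.pow 2).tendsto z₀)
  have h := (Real.continuous_sqrt.tendsto 0).comp hsq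
  rw [Real.sqrt_zero] at h
  refine h.congr fun z => ?_
  simp [Real.sqrt_sq (norm_nonneg _)]

/-! ### The free flow on `L²` -/

lemma fourier_freeFlow (t : ℝ) (φ : L2 n) :
    (𝓕 (freeFlow t φ) : L2 n) = (memLp_freeSymbol_mul t (𝓕 φ : L2 n)).toLp _ := by
  rw [freeFlow, FourierTransform.fourier_fourierInv_eq]

lemma coeFn_fourier_freeFlow (t : ℝ) (φ : L2 n) :
    (𝓕 (freeFlow t φ) : L2 n) =ᵐ[volume] fun ξ => freeSymbol t ξ * (𝓕 φ : L2 n) ξ := by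
  rw [fourier_freeFlow]
  exact MemLp.coeFn_toLp _

lemma eq_of_fourier_eq {f g : L2 n} (h : (𝓕 f : L2 n) = 𝓕 g) : f = g := by
  have h2 : (𝓕⁻ (𝓕 f : L2 n) : L2 n) = 𝓕⁻ (𝓕 g : L2 n) := by rw [h]
  rwa [FourierTransform.fourierInv_fourier_eq, FourierTransform.fourierInv_fourier_eq] at h2

lemma freeFlow_add (t : ℝ) (f g : L2 n) : freeFlow t (f + g) = freeFlow t f + freeFlow t g := by
  refine eq_of_fourier_eq (Lp.ext ?_)
  rw [FourierAdd.fourier_add]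
  filter_upwards [coeFn_fourier_freeFlow t (f + g), coeFn_fourier_freeFlow t f,
    coeFn_fourier_freeFlow t g, Lp.coeFn_add (𝓕 (freeFlow t f) : L2 n) (𝓕 (freeFlow t g) : L2 n),
    Lp.coeFn_add (𝓕 f : L2 n) (𝓕 g : L2 n)] with ξ h1 h2 h3 h4 h5
  rw [h1, h4, Pi.add_apply, h2, h3, FourierAdd.fourier_add, h5, Pi.add_apply, mul_add]

lemma inner_freeFlow (t : ℝ) (f g : L2 n) :
    inner ℂ f (freeFlow t g) = inner ℂ (freeFlow (-t) f) g := by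
  rw [← Lp.inner_fourier_eq, ← Lp.inner_fourier_eq (freeFlow (-t) f), L2.inner_def, L2.inner_def]
  refine integral_congr_ae ?_
  filter_upwards [coeFn_fourier_freeFlow t g, coeFn_fourier_freeFlow (-t) f] with ξ h1 h2
  rw [h1, h2, RCLike.inner_apply, RCLike.inner_apply, map_mul, star_freeSymbol, neg_neg]
  ring

lemma freeFlow_freeFlow (s t : ℝ) (f : L2 n) : freeFlow s (freeFlow t f) = freeFlow (s + t) f := by
  refine eq_of_fourier_eq (Lp.ext ?_)
  filter_upwards [coeFn_fourier_freeFlow s (freeFlow t f), coeFn_fourier_freeFlow t f,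
    coeFn_fourier_freeFlow (s + t) f] with ξ h1 h2 h3
  rw [h1, h2, h3, freeSymbol_add, mul_assoc]

lemma norm_freeFlow (t : ℝ) (f : L2 n) : ‖freeFlow t f‖ = ‖f‖ := by
  rw [← sq_eq_sq₀ (norm_nonneg _) (norm_nonneg _), ← Lp.norm_fourier_eq, ← Lp.norm_fourier_eq f,
    norm_sq_eq_integral, norm_sq_eq_integral]
  refine integral_congr_ae ?_
  filter_upwards [coeFn_fourier_freeFlow t f] with ξ h1
  rw [h1, norm_mul, norm_freeSymbol, one_mul]

lemma freeFlow_sub (t : ℝ) (f g : L2 n) : freeFlow t (f - g) = freeFlow t f - freeFlow t g := by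
  rw [eq_sub_iff_add_eq, ← freeFlow_add, sub_add_cancel]

lemma freeFlow_toLp (t : ℝ) (f : 𝓢(Rn n, ℂ)) :
    freeFlow t (f.toLp 2) = (freeSchwartz t f).toLp 2 := by
  refine eq_of_fourier_eq (Lp.ext ?_)
  have h0 := coeFn_fourier_freeFlow t (f.toLp 2 : L2 n)
  rw [SchwartzMap.toLp_fourier_eq] at h0 ⊢
  filter_upwards [h0, (𝓕 f).coeFn_toLp 2, (𝓕 (freeSchwartz t f)).coeFn_toLp 2] with ξ h1 h2 h3
  rw [h1, h2, h3, fourier_freeSchwartz]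

lemma continuous_freeFlow_left (φ : L2 n) : Continuous fun t : ℝ => freeFlow t φ := by
  have h : Continuous fun t : ℝ =>
      ((memLp_freeSymbol_mul t (𝓕 φ : L2 n)).toLp _ : L2 n) := by
    refine continuous_toLp_of_dominated (fun t => memLp_freeSymbol_mul t (𝓕 φ : L2 n))
      (Lp.memLp (𝓕 φ : L2 n)).norm ?_ ?_
    · intro t
      refine Eventually.of_forall fun ξ => ?_
      rw [norm_mul, norm_freeSymbol, one_mul]
    · refine Eventually.of_forall fun ξ => ?_
      exact (continuous_freeSymbol.comp (by fun_prop : Continuous fun t : ℝ => (t, ξ))).mul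
        continuous_const
  exact (FourierTransform.fourierInvCLM ℂ (L2 n)).continuous.comp h

/-- Strong continuity in time and the isometry property together give continuity when the datum
moves as well. -/
lemma continuous_freeFlow {τ : ℝ → ℝ} (hτ : Continuous τ) {h : ℝ → L2 n} (hh : Continuous h) :
    Continuous fun t => freeFlow (τ t) (h t) := by
  rw [continuous_iff_continuousAt]
  intro t₀
  rw [ContinuousAt, tendsto_iff_norm_sub_tendsto_zero]
  have h1 : Tendsto (fun t => ‖h t - h t₀‖) (𝓝 t₀) (𝓝 0) :=
    tendsto_iff_norm_sub_tendsto_zero.1 (hh.tendsto t₀)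
  have h2 : Tendsto (fun t => ‖freeFlow (τ t) (h t₀) - freeFlow (τ t₀) (h t₀)‖) (𝓝 t₀) (𝓝 0) :=
    tendsto_iff_norm_sub_tendsto_zero.1 (((continuous_freeFlow_left (h t₀)).comp hτ).tendsto t₀)
  refine squeeze_zero (fun _ => norm_nonneg _) (fun t => ?_) (by simpa using h1.add h2)
  have e : freeFlow (τ t) (h t) - freeFlow (τ t₀) (h t₀)
      = freeFlow (τ t) (h t - h t₀) + (freeFlow (τ t) (h t₀) - freeFlow (τ t₀) (h t₀)) := by
    rw [freeFlow_sub]; abel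
  rw [e]
  refine (norm_add_le _ _).trans_eq ?_
  rw [norm_freeFlow]

/-! ### The dispersive estimate -/

lemma star_chirp (t : ℝ) (x : Rn n) : (starRingEnd ℂ) (chirp t x) = chirp (-t) x := by
  rw [chirp, chirp, ← Complex.exp_conj]
  congr 1
  rw [map_mul, Complex.conj_I, Complex.conj_ofReal]
  push_cast
  ring

lemma continuous_chirp (t : ℝ) : Continuous (chirp t : Rn n → ℂ) := by unfold chirp; fun_prop

lemma integrable_chirp_sub_mul (t : ℝ) {φ : Rn n → ℂ} (hφ : Integrable φ) (x : Rn n) :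
    Integrable fun y => chirp t (x - y) * φ y := by
  refine hφ.bdd_mul (c := 1) ?_ ?_
  · exact ((continuous_chirp t).comp (by fun_prop)).aestronglyMeasurable
  · exact Eventually.of_forall fun y => (norm_chirp _ _).le

lemma continuous_integral_chirp (t : ℝ) {φ : Rn n → ℂ} (hφ : Integrable φ) :
    Continuous fun x => ∫ y, chirp t (x - y) * φ y := by
  refine continuous_of_dominated (bound := fun y => ‖φ y‖)
    (fun x => (integrable_chirp_sub_mul t hφ x).1) (fun x => ?_) hφ.norm ?_
  · exact Eventually.of_forall fun y => by rw [norm_mul, norm_chirp, one_mul]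
  · exact Eventually.of_forall fun y =>
      ((continuous_chirp t).comp (by fun_prop)).mul continuous_const

/-- Both sides are compared weakly. Against a smooth compactly supported g the flow is moved onto g
by adjointness, where the Schwartz kernel formula holds; Fubini applies since the kernel is bounded
and φ and g are integrable. -/
lemma freeFlow_ae_eq_integral_kernel {t : ℝ} (ht : t ≠ 0) (φ : L2 n) (hφ : Integrable φ) :
    freeFlow t φ =ᵐ[volume] fun x => kernelConst n t * ∫ y, chirp (1 / t) (x - y) * φ y := by
  refine ae_eq_of_integral_contDiff_smul_eq
    ((Lp.memLp (freeFlow t φ)).locallyIntegrable (by norm_num))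
    (continuous_const.mul (continuous_integral_chirp _ hφ)).locallyIntegrable ?_
  intro g hg hgc
  have hg1 : HasCompactSupport (Complex.ofRealCLM ∘ g) := hgc.comp_left rfl
  have hg2 : ContDiff ℝ (⊤ : ℕ∞) (Complex.ofRealCLM ∘ g) := by fun_prop
  set ψ : 𝓢(Rn n, ℂ) := hg1.toSchwartzMap hg2 with hψ
  have hψx : ∀ x, ψ x = (g x : ℂ) := fun x => rfl
  have e1 : ∫ x, g x • freeFlow t φ x = inner ℂ (ψ.toLp 2 : L2 n) (freeFlow t φ) := by
    rw [L2.inner_def]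
    refine integral_congr_ae ?_
    filter_upwards [ψ.coeFn_toLp 2] with x hx
    rw [hx, hψx, RCLike.inner_apply, Complex.real_smul]
    simp [mul_comm]
  have e2 : inner ℂ (ψ.toLp 2 : L2 n) (freeFlow t φ)
      = ∫ y, ∫ x, kernelConst n t * (chirp (1 / t) (x - y) * φ y * g x) := by
    rw [inner_freeFlow, freeFlow_toLp, L2.inner_def]
    refine integral_congr_ae ?_
    filter_upwards [(freeSchwartz (-t) ψ).coeFn_toLp 2] with y hy
    rw [hy, RCLike.inner_apply, freeSchwartz_eq_integral_kernel (neg_ne_zero.2 ht), map_mul,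
      kernelConst_neg ht, Complex.conj_conj, ← integral_conj, integral_const_mul, mul_left_comm,
      ← integral_const_mul]
    congr 2
    funext x
    rw [map_mul, hψx, Complex.conj_ofReal, star_chirp, ← chirp_neg _ (y - x), neg_sub,
      div_neg, neg_neg]
    ring
  rw [e1, e2, integral_integral_swap]
  · refine integral_congr_ae (Eventually.of_forall fun x => ?_)
    dsimp only
    rw [integral_const_mul, integral_mul_const, Complex.real_smul]
    ring
  · have hgi : Integrable (fun x => (g x : ℂ)) := ψ.integrable
    have h1 : Integrable (fun z : Rn n × Rn n => φ z.1 * (g z.2 : ℂ)) (volume.prod volume) :=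
      hφ.mul_prod hgi
    have h2 : Integrable (fun z : Rn n × Rn n => chirp (1 / t) (z.2 - z.1) * (φ z.1 * (g z.2 : ℂ)))
        (volume.prod volume) := by
      refine h1.bdd_mul (c := 1) ?_ ?_
      · exact ((continuous_chirp (1 / t)).comp (by fun_prop)).aestronglyMeasurable
      · exact Eventually.of_forall fun y => (norm_chirp _ _).le
    refine (h2.const_mul (kernelConst n t)).congr (Eventually.of_forall fun z => ?_)
    simp only [Function.uncurry, mul_assoc]

/-- The dispersive estimate. -/
lemma enorm_freeFlow_le {t : ℝ} (ht : t ≠ 0) (φ : L2 n) (hφ : MemLp φ 1 volume) :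
    ∀ᵐ x, ‖freeFlow t φ x‖ₑ
      ≤ ENNReal.ofReal ((2 * Real.pi * |t|) ^ (-(n : ℝ) / 2)) * ∫⁻ y, ‖φ y‖ₑ := by
  rw [memLp_one_iff_integrable] at hφ
  filter_upwards [freeFlow_ae_eq_integral_kernel ht φ hφ] with x hx
  rw [hx, enorm_mul, ← ofReal_norm (kernelConst n t), norm_kernelConst ht]
  gcongr
  refine (enorm_integral_le_lintegral_enorm _).trans_eq ?_
  refine lintegral_congr fun y => ?_
  rw [enorm_mul, ← ofReal_norm (chirp _ _), norm_chirp, ENNReal.ofReal_one, one_mul]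

/-! ### Exponents -/

/-- The Strichartz exponent `2 + 4/n`. -/
def strichartzExp (n : ℕ) : ℝ := 2 + 4 / n

/-- The exponent dual to `2 + 4/n`. -/
def dualExp (n : ℕ) : ℝ := strichartzExp n / (strichartzExp n - 1)

lemma two_lt_strichartzExp (hn : 1 ≤ n) : 2 < strichartzExp n := by
  have : (0 : ℝ) < n := by exact_mod_cast hn
  rw [strichartzExp]
  have : 0 < 4 / (n : ℝ) := by positivity
  linarith

lemma holderConjugate_dualExp (hn : 1 ≤ n) : (dualExp n).HolderConjugate (strichartzExp n) :=
  (Real.HolderConjugate.conjExponent (by linarith [two_lt_strichartzExp hn])).symm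

/-! ### The dual space-time estimate -/

/-- The constant in the interpolated dispersive estimate. -/
def dispersiveConst (n : ℕ) : ℝ :=
  (4 * strichartzExp n * 2 ^ (strichartzExp n - 2) / (strichartzExp n - 2) *
    (2 * Real.pi) ^ (-2 : ℝ)) ^ (1 / strichartzExp n)

/-- Interpolation with A = (2π|t|)^{-n/2}. Since q - 2 = 4/n, the factor A^{q-2} is a multiple of
|t|^{-2}, and its q-th root is the Riesz kernel to which Hardy–Littlewood–Sobolev applies. -/
lemma enorm_inner_freeFlow_le (hn : 1 ≤ n) {t : ℝ} (ht : t ≠ 0) (f g : L2 n)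
    (hfin : ∫⁻ x, ‖f x‖ₑ ^ dualExp n ≠ ∞) :
    ‖inner ℂ (freeFlow t f) g‖ₑ ≤ ENNReal.ofReal (dispersiveConst n) *
      ((∫⁻ x, ‖f x‖ₑ ^ dualExp n) ^ (1 / dualExp n) *
        ((∫⁻ x, ‖g x‖ₑ ^ dualExp n) ^ (1 / dualExp n) * rieszKernel (strichartzExp n) t)) := by
  have hq := two_lt_strichartzExp hn
  have hn0 : (n : ℝ) ≠ 0 := by positivity
  have hq2 : 0 < strichartzExp n - 2 := by linarith
  have hb : 0 < 2 * Real.pi * |t| := by positivity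
  have h1 : ‖inner ℂ (freeFlow t f) g‖ₑ ≤ ∫⁻ x, ‖freeFlow t f x‖ₑ * ‖g x‖ₑ := by
    rw [L2.inner_def]
    refine (enorm_integral_le_lintegral_enorm _).trans_eq (lintegral_congr fun x => ?_)
    rw [RCLike.inner_apply, enorm_mul, RCLike.enorm_conj, mul_comm]
  refine h1.trans ((lintegral_enorm_apply_mul_enorm_le (holderConjugate_dualExp hn) hq
    (freeFlow_add t) (fun f => (norm_freeFlow t f).le) (Real.rpow_pos_of_pos hb _)
    (fun f hf => enorm_freeFlow_le ht f hf) f g hfin).trans_eq ?_)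
  have e : (4 * strichartzExp n * 2 ^ (strichartzExp n - 2) / (strichartzExp n - 2) *
      ((2 * Real.pi * |t|) ^ (-(n : ℝ) / 2)) ^ (strichartzExp n - 2)) ^ (1 / strichartzExp n)
      = dispersiveConst n * |t| ^ (-(2 / strichartzExp n)) := by
    rw [dispersiveConst, ← Real.rpow_mul hb.le,
      show -(n : ℝ) / 2 * (strichartzExp n - 2) = -2 by rw [strichartzExp]; field_simp; ring,
      Real.mul_rpow (by positivity) (abs_nonneg t), ← mul_assoc,
      Real.mul_rpow (y := |t| ^ (-2 : ℝ)) (by positivity) (by positivity),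
      ← Real.rpow_mul (abs_nonneg t)]
    congr 2
    ring
  rw [e, ENNReal.ofReal_mul (by unfold dispersiveConst; positivity), rieszKernel]
  ring

/-- The dual Strichartz estimate over a bounded time interval. -/
lemma enorm_integral_freeFlow_sq_le (hn : 1 ≤ n) {h : ℝ → L2 n} (hh : Continuous h)
    (hmeas : Measurable fun t => ∫⁻ x, ‖h t x‖ₑ ^ dualExp n)
    (hfin : ∀ t, ∫⁻ x, ‖h t x‖ₑ ^ dualExp n ≠ ∞) (R : ℝ)
    (h_int : ∫⁻ t in Icc (-R) R, ∫⁻ x, ‖h t x‖ₑ ^ dualExp n ≠ ∞) :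
    ‖∫ t in Icc (-R) R, freeFlow (-t) (h t)‖ₑ ^ 2
      ≤ ENNReal.ofReal (dispersiveConst n) * (ENNReal.ofReal (2 * hlsConst (strichartzExp n)) *
        (∫⁻ t in Icc (-R) R, ∫⁻ x, ‖h t x‖ₑ ^ dualExp n) ^ (2 / dualExp n)) := by
  have hq := two_lt_strichartzExp hn
  have hpq := holderConjugate_dualExp hn
  have hp0 : 0 < dualExp n := hpq.pos
  have hc : Continuous fun t => freeFlow (-t) (h t) := continuous_freeFlow continuous_neg hh
  have hI : IntegrableOn (fun t => freeFlow (-t) (h t)) (Icc (-R) R) :=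
    hc.continuousOn.integrableOn_compact isCompact_Icc
  set G : L2 n := ∫ t in Icc (-R) R, freeFlow (-t) (h t) with hG
  -- The L^{q'} norm in space of h t, cut off to the time interval.
  set a : ℝ → ℝ≥0∞ := fun t => (Icc (-R) R).indicator
    (fun t => (∫⁻ x, ‖h t x‖ₑ ^ dualExp n) ^ (1 / dualExp n)) t with ha
  have ham : Measurable a := (hmeas.pow_const _).indicator measurableSet_Icc
  have hap : ∫⁻ t, a t ^ dualExp n = ∫⁻ t in Icc (-R) R, ∫⁻ x, ‖h t x‖ₑ ^ dualExp n := by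
    rw [← lintegral_indicator measurableSet_Icc]
    refine lintegral_congr fun t => ?_
    by_cases ht : t ∈ Icc (-R) R
    · simp only [ha, indicator_of_mem ht]
      rw [← ENNReal.rpow_mul, one_div_mul_cancel hp0.ne', ENNReal.rpow_one]
    · simp only [ha, indicator_of_notMem ht, ENNReal.zero_rpow_of_pos hp0]
  have hinner : ∀ s ∈ Icc (-R) R, ∀ t ∈ Icc (-R) R, t ≠ s →
      ‖inner ℂ (freeFlow (-s) (h s)) (freeFlow (-t) (h t))‖ₑ ≤
        ENNReal.ofReal (dispersiveConst n) *
          (a s * (a t * rieszKernel (strichartzExp n) (t - s))) := by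
    intro s hs t ht hts
    rw [inner_freeFlow, neg_neg, freeFlow_freeFlow, ← sub_eq_add_neg]
    simp only [ha, indicator_of_mem hs, indicator_of_mem ht]
    exact enorm_inner_freeFlow_le hn (sub_ne_zero.2 hts) _ _ (hfin s)
  -- The TT* argument: the squared norm is expanded into a double time integral of inner products,
  -- which the group law reduces to the flow at time t - s.
  have hstep : ‖G‖ₑ ^ 2 ≤ ∫⁻ s in Icc (-R) R, ∫⁻ t in Icc (-R) R,
      ‖inner ℂ (freeFlow (-s) (h s)) (freeFlow (-t) (h t))‖ₑ := by
    have e0 : ‖G‖ₑ ^ 2 = ‖inner ℂ G G‖ₑ := by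
      rw [← ofReal_norm, ← ofReal_norm, inner_self_eq_norm_sq_to_K,
        ← ENNReal.ofReal_pow (by positivity)]
      simp
    have e1 : ∀ v : L2 n, inner ℂ v G = ∫ t in Icc (-R) R, inner ℂ v (freeFlow (-t) (h t)) :=
      fun v => (integral_inner hI v).symm
    have e2 : ‖inner ℂ G G‖ₑ ≤ ∫⁻ s in Icc (-R) R, ‖inner ℂ G (freeFlow (-s) (h s))‖ₑ := by
      rw [e1 G]
      exact enorm_integral_le_lintegral_enorm _
    rw [e0]
    refine e2.trans (lintegral_mono fun s => ?_)
    dsimp only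
    rw [← inner_conj_symm, RCLike.enorm_conj, e1]
    exact enorm_integral_le_lintegral_enorm _
  refine hstep.trans ?_
  have hbound : ∫⁻ s in Icc (-R) R, ∫⁻ t in Icc (-R) R,
      ‖inner ℂ (freeFlow (-s) (h s)) (freeFlow (-t) (h t))‖ₑ
      ≤ ∫⁻ s, ∫⁻ t, ENNReal.ofReal (dispersiveConst n) *
        (a s * (a t * rieszKernel (strichartzExp n) (t - s))) := by
    refine (setLIntegral_mono_ae' measurableSet_Icc (Eventually.of_forall fun s hs => ?_)).trans
      (setLIntegral_le_lintegral _ _)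
    refine (setLIntegral_mono_ae' measurableSet_Icc ?_).trans (setLIntegral_le_lintegral _ _)
    -- The dispersive bound fails to cover t = s, a null set of times.
    have hne : ∀ᵐ t : ℝ, t ≠ s := by
      simp [ae_iff, measure_singleton]
    filter_upwards [hne] with t hts ht
    exact hinner s hs t ht hts
  refine hbound.trans ?_
  simp only [lintegral_const_mul' _ _ ENNReal.ofReal_ne_top]
  rw [← hap]
  gcongr
  exact lintegral_mul_mul_rieszKernel_le hpq hq ham (by rw [hap]; exact h_int)

/-! ### The Strichartz estimate for Schwartz functions -/

/-- The truncated nonlinearity `1_{|x| ≤ R} |u|^{q-2} u` of a solution `u`. -/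
def truncatedPower (f : 𝓢(Rn n, ℂ)) (R t : ℝ) : Rn n → ℂ :=
  (Metric.closedBall 0 R).indicator fun x =>
    ((‖freeSchwartz t f x‖ ^ (strichartzExp n - 2) : ℝ) : ℂ) * freeSchwartz t f x

lemma norm_truncatedPower (hn : 1 ≤ n) (f : 𝓢(Rn n, ℂ)) (R t : ℝ) (x : Rn n) :
    ‖truncatedPower f R t x‖ = (Metric.closedBall 0 R).indicator
      (fun x => ‖freeSchwartz t f x‖ ^ (strichartzExp n - 1)) x := by
  have hq := two_lt_strichartzExp hn
  rw [truncatedPower, norm_indicator_eq_indicator_norm]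
  congr 1
  funext x
  rw [norm_mul, Complex.norm_real, Real.norm_of_nonneg (by positivity),
    ← Real.rpow_add_one' (norm_nonneg _) (by linarith)]
  ring_nf

lemma continuous_power_freeSchwartz (hn : 1 ≤ n) (f : 𝓢(Rn n, ℂ)) :
    Continuous fun z : ℝ × Rn n =>
      ((‖freeSchwartz z.1 f z.2‖ ^ (strichartzExp n - 2) : ℝ) : ℂ) * freeSchwartz z.1 f z.2 := by
  have hq := two_lt_strichartzExp hn
  have h := continuous_freeSchwartz_uncurry f
  exact (Complex.continuous_ofReal.comp (h.norm.rpow_const fun _ => Or.inr (by linarith))).mul h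

lemma norm_truncatedPower_le (hn : 1 ≤ n) (f : 𝓢(Rn n, ℂ)) (R t : ℝ) (x : Rn n) :
    ‖truncatedPower f R t x‖ ≤ (Metric.closedBall 0 R).indicator
      (fun _ => (∫ ξ, ‖𝓕 f ξ‖) ^ (strichartzExp n - 1)) x := by
  have hq := two_lt_strichartzExp hn
  rw [norm_truncatedPower hn]
  refine indicator_le_indicator ?_
  exact Real.rpow_le_rpow (norm_nonneg _) (norm_freeSchwartz_apply_le t f x) (by linarith)

lemma memLp_indicator_closedBall_const (R c : ℝ) :
    MemLp ((Metric.closedBall (0 : Rn n) R).indicator fun _ => c) 2 volume :=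
  memLp_indicator_const 2 Metric.isClosed_closedBall.measurableSet c
    (Or.inr measure_closedBall_lt_top.ne)

lemma memLp_truncatedPower (hn : 1 ≤ n) (f : 𝓢(Rn n, ℂ)) (R t : ℝ) :
    MemLp (truncatedPower f R t) 2 volume := by
  refine (memLp_indicator_closedBall_const R ((∫ ξ, ‖𝓕 f ξ‖) ^ (strichartzExp n - 1))).of_le ?_ ?_
  · refine AEStronglyMeasurable.indicator ?_ Metric.isClosed_closedBall.measurableSet
    exact ((continuous_power_freeSchwartz hn f).comp
      (by fun_prop : Continuous fun x : Rn n => (t, x))).aestronglyMeasurable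
  · exact Eventually.of_forall fun x =>
      (norm_truncatedPower_le hn f R t x).trans (Real.le_norm_self _)

lemma continuous_toLp_truncatedPower (hn : 1 ≤ n) (f : 𝓢(Rn n, ℂ)) (R : ℝ) :
    Continuous fun t => ((memLp_truncatedPower hn f R t).toLp (truncatedPower f R t) : L2 n) := by
  have h1 : ∀ t, ∀ᵐ x, ‖truncatedPower f R t x‖ ≤ (Metric.closedBall (0 : Rn n) R).indicator
      (fun _ => (∫ ξ, ‖𝓕 f ξ‖) ^ (strichartzExp n - 1)) x :=
    fun t => Eventually.of_forall fun x => norm_truncatedPower_le hn f R t x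
  have h2 : ∀ x : Rn n, Continuous fun t => truncatedPower f R t x := by
    intro x
    have hu : Continuous fun t => freeSchwartz t f x := by
      have h := (continuous_freeSchwartz_uncurry f).comp (Continuous.prodMk_left x)
      exact h
    have hc : Continuous fun t : ℝ =>
        ((‖freeSchwartz t f x‖ ^ (strichartzExp n - 2) : ℝ) : ℂ) * freeSchwartz t f x :=
      (Complex.continuous_ofReal.comp (hu.norm.rpow_const fun _ => Or.inr
        (by linarith [two_lt_strichartzExp hn]))).mul hu
    by_cases hx : x ∈ Metric.closedBall (0 : Rn n) R
    · simp only [truncatedPower, indicator_of_mem hx]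
      exact hc
    · simp only [truncatedPower, indicator_of_notMem hx]
      exact continuous_const
  have h3 := memLp_indicator_closedBall_const (n := n) R
    ((∫ ξ, ‖𝓕 f ξ‖) ^ (strichartzExp n - 1))
  have h4 : ∀ᵐ x : Rn n, Continuous fun t => truncatedPower f R t x := Eventually.of_forall h2
  exact continuous_toLp_of_dominated (fun t => memLp_truncatedPower hn f R t) h3 h1 h4

lemma lintegral_truncatedPower (hn : 1 ≤ n) (f : 𝓢(Rn n, ℂ)) (R t : ℝ) :
    ∫⁻ x, ‖((memLp_truncatedPower hn f R t).toLp (truncatedPower f R t) : L2 n) x‖ₑ ^ dualExp n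
      = ∫⁻ x in Metric.closedBall 0 R, ‖freeSchwartz t f x‖ₑ ^ strichartzExp n := by
  have hq := two_lt_strichartzExp hn
  have hpq := holderConjugate_dualExp hn
  have hq0 : 0 ≤ strichartzExp n := by linarith
  have hexp : (strichartzExp n - 1) * dualExp n = strichartzExp n := by
    have := hpq.mul_eq_add
    linarith
  rw [← lintegral_indicator Metric.isClosed_closedBall.measurableSet]
  refine lintegral_congr_ae ?_
  filter_upwards [(memLp_truncatedPower hn f R t).coeFn_toLp] with x hx
  rw [hx, ← ofReal_norm, norm_truncatedPower hn]
  by_cases hxR : x ∈ Metric.closedBall (0 : Rn n) R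
  · rw [indicator_of_mem hxR, indicator_of_mem hxR,
      ENNReal.ofReal_rpow_of_nonneg (by positivity) hpq.pos.le, ← Real.rpow_mul (norm_nonneg _),
      ← ofReal_norm, ENNReal.ofReal_rpow_of_nonneg (norm_nonneg _) hq0, hexp]
  · rw [indicator_of_notMem hxR, indicator_of_notMem hxR, ENNReal.ofReal_zero,
      ENNReal.zero_rpow_of_pos hpq.pos]

lemma inner_truncatedPower (hn : 1 ≤ n) (f : 𝓢(Rn n, ℂ)) (R t : ℝ) :
    inner ℂ ((memLp_truncatedPower hn f R t).toLp (truncatedPower f R t) : L2 n)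
      (freeFlow t (f.toLp 2))
      = ((∫ x in Metric.closedBall 0 R, ‖freeSchwartz t f x‖ ^ strichartzExp n : ℝ) : ℂ) := by
  have hq := two_lt_strichartzExp hn
  rw [freeFlow_toLp, L2.inner_def, ← integral_complex_ofReal,
    ← integral_indicator Metric.isClosed_closedBall.measurableSet]
  refine integral_congr_ae ?_
  filter_upwards [(memLp_truncatedPower hn f R t).coeFn_toLp,
    (freeSchwartz t f).coeFn_toLp 2] with x hx hx2
  rw [hx, hx2, RCLike.inner_apply, truncatedPower]
  by_cases hxR : x ∈ Metric.closedBall (0 : Rn n) R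
  · rw [indicator_of_mem hxR, indicator_of_mem hxR, map_mul, Complex.conj_ofReal, mul_left_comm,
      Complex.mul_conj, Complex.normSq_eq_norm_sq, ← Complex.ofReal_mul]
    congr 1
    rw [← Real.rpow_natCast, ← Real.rpow_add' (norm_nonneg _) (by push_cast; linarith)]
    push_cast
    ring_nf
  · rw [indicator_of_notMem hxR, indicator_of_notMem hxR, map_zero, mul_zero]

lemma integrableOn_closedBall_rpow (hn : 1 ≤ n) (f : 𝓢(Rn n, ℂ)) (R t : ℝ) :
    IntegrableOn (fun x => ‖freeSchwartz t f x‖ ^ strichartzExp n) (Metric.closedBall 0 R) := by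
  have hq := two_lt_strichartzExp hn
  refine ContinuousOn.integrableOn_compact (isCompact_closedBall _ _) (Continuous.continuousOn ?_)
  exact (freeSchwartz t f).continuous.norm.rpow_const fun _ => Or.inr (by linarith)

lemma setLIntegral_closedBall_eq_ofReal (hn : 1 ≤ n) (f : 𝓢(Rn n, ℂ)) (R t : ℝ) :
    ∫⁻ x in Metric.closedBall 0 R, ‖freeSchwartz t f x‖ₑ ^ strichartzExp n
      = ENNReal.ofReal (∫ x in Metric.closedBall 0 R, ‖freeSchwartz t f x‖ ^ strichartzExp n) := by
  have hq := two_lt_strichartzExp hn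
  rw [ofReal_integral_eq_lintegral_ofReal (integrableOn_closedBall_rpow hn f R t)
    (Eventually.of_forall fun x => by positivity)]
  refine lintegral_congr fun x => ?_
  rw [← ofReal_norm, ENNReal.ofReal_rpow_of_nonneg (norm_nonneg _) (by linarith)]

/-- The constant in the Strichartz estimate. -/
def strichartzConst (n : ℕ) : ℝ≥0∞ :=
  (ENNReal.ofReal (dispersiveConst n) * ENNReal.ofReal (2 * hlsConst (strichartzExp n)))
    ^ (1 / 2 : ℝ)

lemma strichartzConst_ne_top (n : ℕ) : strichartzConst n ≠ ∞ :=
  ENNReal.rpow_ne_top_of_nonneg (by norm_num)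
    (ENNReal.mul_ne_top ENNReal.ofReal_ne_top ENNReal.ofReal_ne_top)

lemma measurable_enorm_freeSchwartz_rpow (f : 𝓢(Rn n, ℂ)) (r : ℝ) :
    Measurable fun z : ℝ × Rn n => ‖freeSchwartz z.1 f z.2‖ₑ ^ r :=
  (continuous_freeSchwartz_uncurry f).measurable.enorm.pow_const _

/-- Absorption: division by X^{1/p} leaves X^{1/q} ≤ C. It needs X finite, which is why the
Strichartz estimate is proved on bounded regions first. -/
lemma le_rpow_of_le_mul_rpow {p q : ℝ} (hpq : p.HolderConjugate q) {X C : ℝ≥0∞} (hX : X ≠ ∞)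
    (h : X ≤ C * X ^ (1 / p)) : X ≤ C ^ q := by
  have hp0 : 0 < p := hpq.pos
  have hq0 : 0 < q := hpq.symm.pos
  rcases eq_or_ne X 0 with h0 | h0
  · rw [h0]; exact zero_le
  have e : X ^ (1 / q) * X ^ (1 / p) = X := by
    rw [← ENNReal.rpow_add _ _ h0 hX, one_div, one_div, add_comm, hpq.inv_add_inv_eq_one,
      ENNReal.rpow_one]
  have hne0 : X ^ (1 / p) ≠ 0 := (ENNReal.rpow_pos (pos_iff_ne_zero.2 h0) hX).ne'
  have hnet : X ^ (1 / p) ≠ ∞ := ENNReal.rpow_ne_top_of_nonneg (by positivity) hX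
  have h4 : X ^ (1 / q) ≤ C := (ENNReal.mul_le_mul_iff_left hne0 hnet).1 (e.le.trans h)
  calc X = (X ^ (1 / q)) ^ q := by
        rw [← ENNReal.rpow_mul, one_div_mul_cancel hq0.ne', ENNReal.rpow_one]
    _ ≤ C ^ q := ENNReal.rpow_le_rpow h4 hq0.le

/-- Duality with the solution itself: for h = |u|^{q-2}u on the truncated region, the integral X of
|u|^q is the inner product of f with ∫ U₀(-t)h(t) dt. As |h|^{q'} = |u|^q, the dual estimate bounds
the latter by a multiple of X^{1/q'}, and X is absorbed. -/
lemma setLIntegral_freeSchwartz_rpow_le (hn : 1 ≤ n) (f : 𝓢(Rn n, ℂ)) (R : ℝ) :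
    ∫⁻ t in Icc (-R) R, ∫⁻ x in Metric.closedBall 0 R, ‖freeSchwartz t f x‖ₑ ^ strichartzExp n
      ≤ (strichartzConst n * ‖(f.toLp 2 : L2 n)‖ₑ) ^ strichartzExp n := by
  have hq := two_lt_strichartzExp hn
  have hpq := holderConjugate_dualExp hn
  have hp0 : 0 < dualExp n := hpq.pos
  set h : ℝ → L2 n := fun t => (memLp_truncatedPower hn f R t).toLp (truncatedPower f R t) with hh
  have hcont : Continuous h := continuous_toLp_truncatedPower hn f R
  set Y : ℝ → ℝ := fun t => ∫ x in Metric.closedBall 0 R, ‖freeSchwartz t f x‖ ^ strichartzExp n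
  have hY : ∀ t, inner ℂ (h t) (freeFlow t (f.toLp 2)) = ((Y t : ℝ) : ℂ) :=
    inner_truncatedPower hn f R
  have hN : ∀ t, ∫⁻ x, ‖h t x‖ₑ ^ dualExp n = ENNReal.ofReal (Y t) := fun t => by
    rw [hh, lintegral_truncatedPower hn, setLIntegral_closedBall_eq_ofReal hn]
  have hY0 : ∀ t, 0 ≤ Y t := fun t => integral_nonneg fun x => by positivity
  have hYc : Continuous Y := by
    have : Continuous fun t => ((Y t : ℝ) : ℂ) := by
      simp only [← hY]
      exact hcont.inner (continuous_freeFlow continuous_id continuous_const)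
    exact Complex.continuous_re.comp this
  have hYi : IntegrableOn Y (Icc (-R) R) := hYc.continuousOn.integrableOn_compact isCompact_Icc
  simp only [setLIntegral_closedBall_eq_ofReal hn]
  set X : ℝ≥0∞ := ∫⁻ t in Icc (-R) R, ENNReal.ofReal (Y t) with hX
  have hXr : X = ENNReal.ofReal (∫ t in Icc (-R) R, Y t) :=
    (ofReal_integral_eq_lintegral_ofReal hYi (Eventually.of_forall hY0)).symm
  have hXfin : X ≠ ∞ := by rw [hXr]; exact ENNReal.ofReal_ne_top
  set G : L2 n := ∫ t in Icc (-R) R, freeFlow (-t) (h t) with hG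
  have hI : IntegrableOn (fun t => freeFlow (-t) (h t)) (Icc (-R) R) :=
    (continuous_freeFlow continuous_neg hcont).continuousOn.integrableOn_compact isCompact_Icc
  have hpair : inner ℂ (f.toLp 2 : L2 n) G = ((∫ t in Icc (-R) R, Y t : ℝ) : ℂ) := by
    rw [hG, ← integral_inner hI, ← integral_complex_ofReal]
    refine integral_congr_ae (Eventually.of_forall fun t => ?_)
    dsimp only
    rw [← hY, inner_freeFlow (-t), neg_neg, ← inner_conj_symm, hY, Complex.conj_ofReal]
  have h1 : X ≤ ‖(f.toLp 2 : L2 n)‖ₑ * ‖G‖ₑ := by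
    rw [hXr, ← ofReal_norm, ← ofReal_norm, ← ENNReal.ofReal_mul (norm_nonneg _)]
    refine ENNReal.ofReal_le_ofReal ?_
    refine le_trans (le_trans (Real.le_norm_self _) ?_) (norm_inner_le_norm (𝕜 := ℂ) _ _)
    rw [hpair, Complex.norm_real]
  have h2 : ‖G‖ₑ ≤ strichartzConst n * X ^ (1 / dualExp n) := by
    have h3 := enorm_integral_freeFlow_sq_le hn hcont
      (by simp only [hN]; exact hYc.measurable.ennreal_ofReal)
      (fun t => by rw [hN]; exact ENNReal.ofReal_ne_top) R
      (by simp only [hN]; exact hXfin)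
    simp only [hN] at h3
    rw [← hG, ← hX, ← mul_assoc] at h3
    have h4 := ENNReal.rpow_le_rpow h3 (z := 1 / 2) (by norm_num)
    rw [ENNReal.mul_rpow_of_nonneg _ _ (by norm_num), ← ENNReal.rpow_mul,
      ← ENNReal.rpow_natCast, ← ENNReal.rpow_mul] at h4
    rw [strichartzConst]
    convert h4 using 2
    · norm_num
    · congr 1
      ring
  have h3 : X ≤ strichartzConst n * ‖(f.toLp 2 : L2 n)‖ₑ * X ^ (1 / dualExp n) := by
    refine h1.trans ((mul_le_mul_right h2 _).trans_eq ?_)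
    ring
  exact le_rpow_of_le_mul_rpow hpq hXfin h3

/-- The Strichartz estimate for Schwartz functions. -/
lemma lintegral_freeSchwartz_rpow_le (hn : 1 ≤ n) (f : 𝓢(Rn n, ℂ)) :
    ∫⁻ z : ℝ × Rn n, ‖freeSchwartz z.1 f z.2‖ₑ ^ strichartzExp n
      ≤ (strichartzConst n * ‖(f.toLp 2 : L2 n)‖ₑ) ^ strichartzExp n := by
  -- The bound does not depend on R, so it passes to the union of an increasing exhaustion.
  set K : ℕ → Set (ℝ × Rn n) := fun k => Icc (-(k : ℝ)) k ×ˢ Metric.closedBall 0 k with hK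
  have hmono : Monotone K := by
    intro k l hkl
    have h : (k : ℝ) ≤ l := by exact_mod_cast hkl
    exact prod_mono (Icc_subset_Icc (neg_le_neg h) h) (Metric.closedBall_subset_closedBall h)
  have hunion : ⋃ k, K k = univ := by
    refine eq_univ_of_forall fun z => ?_
    obtain ⟨k, hk⟩ := exists_nat_ge (max |z.1| ‖z.2‖)
    refine mem_iUnion.2 ⟨k, ?_⟩
    exact ⟨abs_le.1 ((le_max_left _ _).trans hk),
      by simpa using (le_max_right _ _).trans hk⟩
  rw [← setLIntegral_univ, ← hunion, setLIntegral_iUnion_of_directed _ hmono.directed_le]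
  refine iSup_le fun k => ?_
  rw [Measure.volume_eq_prod, setLIntegral_prod _
    (measurable_enorm_freeSchwartz_rpow f _).aemeasurable]
  exact setLIntegral_freeSchwartz_rpow_le hn f k

/-! ### The Fourier transform on `L²` -/

lemma ae_comp_smul {c : ℝ} (hc : c ≠ 0) {P : Rn n → Prop} (h : ∀ᵐ x, P x) : ∀ᵐ x, P (c • x) := by
  have hmap := Measure.map_addHaar_smul (volume : Measure (Rn n)) hc
  have hq : Measure.QuasiMeasurePreserving (fun x : Rn n => c • x) volume volume := by
    refine ⟨measurable_const_smul c, ?_⟩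
    rw [hmap]
    exact Measure.smul_absolutelyContinuous
  exact hq.ae h

lemma coeFn_fourierL2 (φ : L2 n) : fourierL2 φ =ᵐ[volume]
    fun ξ => fourierConst n * (𝓕 φ : L2 n) ((2 * Real.pi)⁻¹ • ξ) :=
  MemLp.coeFn_toLp _

lemma fourierL2_sub (φ ψ : L2 n) : fourierL2 (φ - ψ) = fourierL2 φ - fourierL2 ψ := by
  have hc : ((2 * Real.pi)⁻¹ : ℝ) ≠ 0 := by positivity
  have e : (𝓕 (φ - ψ) : L2 n) = 𝓕 φ - 𝓕 ψ := map_sub (FourierTransform.fourierCLM ℂ (L2 n)) φ ψ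
  refine Lp.ext ?_
  filter_upwards [coeFn_fourierL2 (φ - ψ), coeFn_fourierL2 φ, coeFn_fourierL2 ψ,
    Lp.coeFn_sub (fourierL2 φ) (fourierL2 ψ),
    ae_comp_smul hc (Lp.coeFn_sub (𝓕 φ : L2 n) (𝓕 ψ : L2 n))] with ξ h1 h2 h3 h4 h5
  rw [h1, h4, Pi.sub_apply, h2, h3, e, h5, Pi.sub_apply, mul_sub]

lemma norm_fourierL2 (φ : L2 n) : ‖fourierL2 φ‖ = ‖φ‖ := by
  have hπ : 0 < 2 * Real.pi := by positivity
  rw [← sq_eq_sq₀ (norm_nonneg _) (norm_nonneg _), ← Lp.norm_fourier_eq φ, norm_sq_eq_integral,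
    norm_sq_eq_integral]
  have h1 : ∫ ξ, ‖fourierL2 φ ξ‖ ^ 2
      = ∫ ξ, ‖fourierConst n‖ ^ 2 * ‖(𝓕 φ : L2 n) ((2 * Real.pi)⁻¹ • ξ)‖ ^ 2 := by
    refine integral_congr_ae ?_
    filter_upwards [coeFn_fourierL2 φ] with ξ hξ
    rw [hξ, norm_mul, mul_pow]
  rw [h1, integral_const_mul, Measure.integral_comp_smul (volume : Measure (Rn n))
    (fun v => ‖(𝓕 φ : L2 n) v‖ ^ 2) ((2 * Real.pi)⁻¹), finrank_euclideanSpace_fin, inv_pow, inv_inv,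
    abs_of_pos (by positivity), smul_eq_mul, ← mul_assoc]
  have h := congrArg norm (fourierConst_mul_self (n := n))
  rw [norm_mul, norm_mul, norm_one, Complex.norm_real, Real.norm_of_nonneg (by positivity)] at h
  linear_combination (∫ x, ‖(𝓕 φ : L2 n) x‖ ^ 2) * h

lemma fourierL2_toLp (f : 𝓢(Rn n, ℂ)) : fourierL2 (f.toLp 2) = (fourierSchwartz n f).toLp 2 := by
  have hc : ((2 * Real.pi)⁻¹ : ℝ) ≠ 0 := by positivity
  have h0 := coeFn_fourierL2 (f.toLp 2 : L2 n)
  rw [SchwartzMap.toLp_fourier_eq] at h0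
  have h2 : ∀ᵐ ξ, ((𝓕 f).toLp 2 : L2 n) ξ = 𝓕 f ξ := (𝓕 f).coeFn_toLp 2 volume
  refine Lp.ext ?_
  filter_upwards [h0, ae_comp_smul hc h2,
    (fourierSchwartz n f).coeFn_toLp 2] with ξ h1 h2 h3
  rw [h1, h2, h3, fourierSchwartz_apply]

lemma continuous_fourierL2 : Continuous (fourierL2 : L2 n → L2 n) :=
  (Isometry.of_dist_eq fun φ ψ => by
    rw [dist_eq_norm, dist_eq_norm, ← fourierL2_sub, norm_fourierL2]).continuous

lemma continuous_freeFlow_right (t : ℝ) : Continuous (freeFlow t : L2 n → L2 n) :=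
  (Isometry.of_dist_eq fun φ ψ => by
    rw [dist_eq_norm, dist_eq_norm, ← freeFlow_sub, norm_freeFlow]).continuous

/-! ### Approximation by Schwartz functions -/

lemma exists_schwartz_tendsto (φ : L2 n) :
    ∃ f : ℕ → 𝓢(Rn n, ℂ), Tendsto (fun k => ((f k).toLp 2 : L2 n)) atTop (𝓝 φ) := by
  have h := SchwartzMap.denseRange_toLpCLM (E := Rn n) (F := ℂ) (p := 2)
    (μ := volume) (by norm_num) φ
  obtain ⟨u, hu, hlim⟩ := mem_closure_iff_seq_limit.1 h
  choose f hf using hu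
  refine ⟨f, ?_⟩
  convert hlim using 1
  funext k
  rw [← hf k]
  rfl

lemma exists_subseq_tendsto_ae {α : Type*} [MeasurableSpace α] {μ : Measure α} {p : ℝ≥0∞}
    [Fact (1 ≤ p)] {g : ℕ → Lp ℂ p μ} {g₀ : Lp ℂ p μ} (h : Tendsto g atTop (𝓝 g₀)) :
    ∃ ns : ℕ → ℕ, StrictMono ns ∧
      ∀ᵐ x ∂μ, Tendsto (fun k => g (ns k) x) atTop (𝓝 (g₀ x)) :=
  (tendstoInMeasure_of_tendsto_Lp h).exists_seq_tendsto_ae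

/-- The pseudoconformal transformation on `L²`. -/
lemma freeFlow_ae_eq_conformal {t : ℝ} (ht : t ≠ 0) (φ : L2 n) :
    ∀ᵐ x, freeFlow t φ x = conformalConst n t * chirp (1 / t) x *
      freeFlow (-(1 / t)) (fourierL2 φ) (t⁻¹ • x) := by
  obtain ⟨f, hf⟩ := exists_schwartz_tendsto φ
  have hA : Tendsto (fun k => freeFlow t ((f k).toLp 2)) atTop (𝓝 (freeFlow t φ)) :=
    ((continuous_freeFlow_right t).tendsto φ).comp hf
  obtain ⟨ns, hns, hA'⟩ := exists_subseq_tendsto_ae hA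
  -- The second subsequence is taken inside the first, so that both sides of the Schwartz identity
  -- converge almost everywhere along it.
  have hB : Tendsto (fun k => freeFlow (-(1 / t)) (fourierL2 ((f (ns k)).toLp 2))) atTop
      (𝓝 (freeFlow (-(1 / t)) (fourierL2 φ))) :=
    (((continuous_freeFlow_right _).comp continuous_fourierL2).tendsto φ).comp
      (hf.comp hns.tendsto_atTop)
  obtain ⟨ms, hms, hB'⟩ := exists_subseq_tendsto_ae hB
  have e1 : ∀ᵐ x, ∀ k, freeFlow t ((f k).toLp 2) x = freeSchwartz t (f k) x := by
    rw [ae_all_iff]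
    intro k
    rw [freeFlow_toLp]
    exact (freeSchwartz t (f k)).coeFn_toLp 2
  have e2 : ∀ᵐ x, ∀ k, freeFlow (-(1 / t)) (fourierL2 ((f k).toLp 2)) x
      = freeSchwartz (-(1 / t)) (fourierSchwartz n (f k)) x := by
    rw [ae_all_iff]
    intro k
    rw [fourierL2_toLp, freeFlow_toLp]
    exact (freeSchwartz (-(1 / t)) (fourierSchwartz n (f k))).coeFn_toLp 2
  filter_upwards [hA', e1, ae_comp_smul (inv_ne_zero ht) hB', ae_comp_smul (inv_ne_zero ht) e2]
    with x h1 h2 h3 h4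
  refine tendsto_nhds_unique (h1.comp hms.tendsto_atTop)
    ((h3.const_mul (conformalConst n t * chirp (1 / t) x)).congr fun k => ?_)
  rw [Function.comp_apply, h2, h4, freeSchwartz_eq_conformal ht]

/-! ### The Strichartz estimate on `L²` -/

lemma eLpNorm_freeSchwartz_le (hn : 1 ≤ n) (f : 𝓢(Rn n, ℂ)) :
    eLpNorm (fun z : ℝ × Rn n => freeSchwartz z.1 f z.2) (ENNReal.ofReal (strichartzExp n)) volume
      ≤ strichartzConst n * ‖(f.toLp 2 : L2 n)‖ₑ := by
  have hq := two_lt_strichartzExp hn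
  have hq0 : 0 < strichartzExp n := by linarith
  rw [eLpNorm_eq_lintegral_rpow_enorm_toReal (by simpa using hq0) ENNReal.ofReal_ne_top,
    ENNReal.toReal_ofReal hq0.le]
  refine (ENNReal.rpow_le_rpow (lintegral_freeSchwartz_rpow_le hn f) (by positivity)).trans_eq ?_
  rw [← ENNReal.rpow_mul, mul_one_div_cancel hq0.ne', ENNReal.rpow_one]

lemma memLp_freeSchwartz (hn : 1 ≤ n) (f : 𝓢(Rn n, ℂ)) :
    MemLp (fun z : ℝ × Rn n => freeSchwartz z.1 f z.2) (ENNReal.ofReal (strichartzExp n))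
      volume :=
  ⟨(continuous_freeSchwartz_uncurry f).aestronglyMeasurable,
    (eLpNorm_freeSchwartz_le hn f).trans_lt
      (ENNReal.mul_lt_top (strichartzConst_ne_top n).lt_top (by simp))⟩

/-- The exponent `2 + 4/n` defines a Banach space. -/
lemma fact_one_le_strichartzExp (hn : 1 ≤ n) : Fact (1 ≤ ENNReal.ofReal (strichartzExp n)) :=
  ⟨by
    rw [← ENNReal.ofReal_one]
    exact ENNReal.ofReal_le_ofReal (by linarith [two_lt_strichartzExp hn])⟩

/-- The free solution with Schwartz data as an element of `L^{2+4/n}(ℝ × ℝⁿ)`. -/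
def solutionLp (hn : 1 ≤ n) (f : 𝓢(Rn n, ℂ)) :
    Lp ℂ (ENNReal.ofReal (strichartzExp n)) (volume : Measure (ℝ × Rn n)) :=
  (memLp_freeSchwartz hn f).toLp (fun z : ℝ × Rn n => freeSchwartz z.1 f z.2)

lemma solutionLp_sub (hn : 1 ≤ n) (f g : 𝓢(Rn n, ℂ)) :
    solutionLp hn f - solutionLp hn g = solutionLp hn (f - g) := by
  refine Lp.ext ?_
  filter_upwards [Lp.coeFn_sub (solutionLp hn f) (solutionLp hn g),
    (memLp_freeSchwartz hn f).coeFn_toLp, (memLp_freeSchwartz hn g).coeFn_toLp,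
    (memLp_freeSchwartz hn (f - g)).coeFn_toLp] with z h1 h2 h3 h4
  rw [h1, Pi.sub_apply, solutionLp, solutionLp, solutionLp, h2, h3, h4, map_sub]
  rfl

lemma dist_solutionLp_le (hn : 1 ≤ n) (f g : 𝓢(Rn n, ℂ)) :
    dist (solutionLp hn f) (solutionLp hn g)
      ≤ (strichartzConst n).toReal * dist (f.toLp 2 : L2 n) (g.toLp 2 : L2 n) := by
  have := fact_one_le_strichartzExp hn
  have e2 : (f.toLp 2 : L2 n) - (g.toLp 2 : L2 n) = ((f - g).toLp 2 : L2 n) :=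
    (map_sub (SchwartzMap.toLpCLM ℂ ℂ 2 (volume : Measure (Rn n))) f g).symm
  rw [dist_eq_norm, dist_eq_norm, solutionLp_sub, e2, solutionLp, Lp.norm_toLp, ← toReal_enorm,
    ← ENNReal.toReal_mul]
  exact ENNReal.toReal_mono (ENNReal.mul_ne_top (strichartzConst_ne_top n) (by simp))
    (eLpNorm_freeSchwartz_le hn (f - g))

lemma cauchySeq_solutionLp (hn : 1 ≤ n) {f : ℕ → 𝓢(Rn n, ℂ)}
    (hf : CauchySeq fun k => ((f k).toLp 2 : L2 n)) :
    haveI := fact_one_le_strichartzExp hn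
    CauchySeq fun k => solutionLp hn (f k) := by
  have := fact_one_le_strichartzExp hn
  rw [Metric.cauchySeq_iff]
  intro ε hε
  obtain ⟨N, hN⟩ := Metric.cauchySeq_iff.1 hf
    (ε / ((strichartzConst n).toReal + 1)) (by positivity)
  refine ⟨N, fun k hk l hl => ?_⟩
  have h1 := hN k hk l hl
  rw [lt_div_iff₀ (by positivity)] at h1
  refine (dist_solutionLp_le hn (f k) (f l)).trans_lt (lt_of_le_of_lt ?_ h1)
  rw [mul_comm]
  exact mul_le_mul_of_nonneg_left (by linarith) dist_nonneg

/-- The Strichartz estimate: free solutions have a jointly measurable version in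
`L^{2+4/n}(ℝ × ℝⁿ)`. -/
lemma exists_memLp_freeFlow (hn : 1 ≤ n) (φ : L2 n) :
    ∃ v : ℝ × Rn n → ℂ, MemLp v (ENNReal.ofReal (strichartzExp n)) volume ∧
      ∀ᵐ t : ℝ, ∀ᵐ x, v (t, x) = freeFlow t φ x := by
  have := fact_one_le_strichartzExp hn
  obtain ⟨f, hf⟩ := exists_schwartz_tendsto φ
  obtain ⟨v, hv⟩ := cauchySeq_tendsto_of_complete (cauchySeq_solutionLp hn hf.cauchySeq)
  obtain ⟨ns, hns, hae⟩ := exists_subseq_tendsto_ae hv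
  refine ⟨v, Lp.memLp v, ?_⟩
  have hVk : ∀ᵐ z : ℝ × Rn n, ∀ k, solutionLp hn (f k) z = freeSchwartz z.1 (f k) z.2 := by
    rw [ae_all_iff]
    exact fun k => (memLp_freeSchwartz hn (f k)).coeFn_toLp
  have hz : ∀ᵐ z : ℝ × Rn n,
      Tendsto (fun k => freeSchwartz z.1 (f (ns k)) z.2) atTop (𝓝 (v z)) := by
    filter_upwards [hae, hVk] with z h1 h2
    exact h1.congr fun k => h2 (ns k)
  filter_upwards [Measure.ae_ae_of_ae_prod hz] with t ht
  -- The space-time limit is identified slice by slice. The further subsequence may depend on t,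
  -- because only the limit is compared.
  have hB : Tendsto (fun k => freeFlow t ((f (ns k)).toLp 2)) atTop (𝓝 (freeFlow t φ)) :=
    ((continuous_freeFlow_right t).tendsto φ).comp (hf.comp hns.tendsto_atTop)
  obtain ⟨ms, hms, hB'⟩ := exists_subseq_tendsto_ae hB
  have e1 : ∀ᵐ x, ∀ k, freeFlow t ((f k).toLp 2) x = freeSchwartz t (f k) x := by
    rw [ae_all_iff]
    intro k
    rw [freeFlow_toLp]
    exact (freeSchwartz t (f k)).coeFn_toLp 2
  filter_upwards [ht, hB', e1] with x h1 h2 h3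
  exact tendsto_nhds_unique (h1.comp hms.tendsto_atTop) (h2.congr fun k => h3 _)

/-! ### Functions as tempered distributions -/

lemma isTempered_of_ae_eq_memLp {p : ℝ≥0∞} [hp : Fact (1 ≤ p)] {f g : Rn n → ℂ}
    (hg : MemLp g p volume) (hfg : g =ᵐ[volume] f) : IsTempered f := by
  have := ENNReal.HolderConjugate.inv_one_sub_inv' hp.out
  refine ⟨((hg.toLp g : Lp ℂ p (volume : Measure (Rn n))) : 𝓢'(Rn n, ℂ)), fun ψ => ⟨?_, ?_⟩⟩
  · have h : Integrable (fun x => ψ x * g x) volume :=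
      (ψ.memLp (1 - p⁻¹)⁻¹ volume).integrable_mul hg
    exact h.congr (hfg.mono fun x hx => by simp only [hx])
  · rw [Lp.toTemperedDistribution_apply]
    refine integral_congr_ae ?_
    filter_upwards [hg.coeFn_toLp, hfg] with x h1 h2
    rw [h1, h2, smul_eq_mul]

/-- The choice in `distOf` is harmless: every representing distribution has these values. -/
lemma distOf_apply {f : Rn n → ℂ} (hf : IsTempered f) (ψ : 𝓢(Rn n, ℂ)) :
    distOf f ψ = ∫ x, ψ x * f x := by
  rw [distOf, dif_pos hf]
  exact (hf.choose_spec ψ).2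

/-! ### Riesz representation on Schwartz functions -/

/-- Density of Schwartz functions extends Λ to L², where Riesz gives Λ ψ = ⟨g, ψ⟩. The
distributional pairing carries no conjugation, so the representative is the conjugate of g. -/
lemma exists_L2_representing (Λ : 𝓢(Rn n, ℂ) →ₗ[ℂ] ℂ) {M : ℝ} (hM : 0 ≤ M)
    (hΛ : ∀ ψ, ‖Λ ψ‖ ≤ M * ‖(ψ.toLp 2 : L2 n)‖) :
    ∃ J : L2 n, ‖J‖ ≤ M ∧ ∀ ψ, Λ ψ = (J : 𝓢'(Rn n, ℂ)) ψ := by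
  set e : 𝓢(Rn n, ℂ) →ₗ[ℂ] L2 n :=
    (SchwartzMap.toLpCLM ℂ ℂ 2 (volume : Measure (Rn n))).toLinearMap with he
  have hd : DenseRange e :=
    SchwartzMap.denseRange_toLpCLM (E := Rn n) (F := ℂ) (p := 2) (μ := volume) (by norm_num)
  have hΛ' : ∀ ψ, ‖Λ ψ‖ ≤ M * ‖e ψ‖ := hΛ
  set ℓ : L2 n →L[ℂ] ℂ := Λ.extendOfNorm e with hℓ
  have hℓn : ‖ℓ‖ ≤ M := LinearMap.opNorm_extendOfNorm_le hd hM hΛ'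
  set g : L2 n := (InnerProductSpace.toDual ℂ (L2 n)).symm ℓ with hg
  have hgn : ‖g‖ ≤ M := by rwa [hg, LinearIsometryEquiv.norm_map]
  refine ⟨star g, ?_, fun ψ => ?_⟩
  · have : ‖(star g : L2 n)‖ = ‖g‖ := by
      rw [← sq_eq_sq₀ (norm_nonneg _) (norm_nonneg _), norm_sq_eq_integral, norm_sq_eq_integral]
      refine integral_congr_ae ?_
      filter_upwards [Lp.coeFn_star g] with x hx
      rw [hx, Pi.star_apply, norm_star]
    rwa [this]
  · have h1 : Λ ψ = inner ℂ g (e ψ) := by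
      rw [hg, InnerProductSpace.toDual_symm_apply, hℓ, LinearMap.extendOfNorm_eq hd ⟨M, hΛ'⟩]
    rw [h1, L2.inner_def, Lp.toTemperedDistribution_apply]
    refine integral_congr_ae ?_
    filter_upwards [Lp.coeFn_star g, ψ.coeFn_toLp 2 (volume : Measure (Rn n))] with x hx h2
    have h3 : (e ψ : L2 n) x = ψ x := h2
    rw [h3, hx, RCLike.inner_apply, Pi.star_apply, smul_eq_mul]
    rfl

lemma eq_of_forall_schwartz {I J : L2 n}
    (h : ∀ ψ : 𝓢(Rn n, ℂ), (I : 𝓢'(Rn n, ℂ)) ψ = (J : 𝓢'(Rn n, ℂ)) ψ) : I = J := by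
  have hker := Lp.ker_toTemperedDistributionCLM_eq_bot (E := Rn n) (F := ℂ) (p := 2)
    (μ := volume)
  rw [LinearMap.ker_eq_bot] at hker
  refine hker ?_
  ext ψ
  exact h ψ

/-! ### The space-time nonlinearity -/

lemma strichartzExp_sub_one (n : ℕ) : strichartzExp n - 1 = 4 / n + 1 := by
  rw [strichartzExp]; ring

lemma norm_power_mul (z : ℂ) : ‖((‖z‖ ^ (4 / (n : ℝ)) : ℝ) : ℂ) * z‖
    = ‖z‖ ^ (strichartzExp n - 1) := by
  have h : 0 ≤ 4 / (n : ℝ) := by positivity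
  rw [norm_mul, Complex.norm_real, Real.norm_of_nonneg (by positivity), strichartzExp_sub_one,
    Real.rpow_add_one' (norm_nonneg _) (by linarith)]

lemma continuous_power_mul : Continuous fun z : ℂ => ((‖z‖ ^ (4 / (n : ℝ)) : ℝ) : ℂ) * z := by
  have h : 0 ≤ 4 / (n : ℝ) := by positivity
  exact (Complex.continuous_ofReal.comp (continuous_norm.rpow_const fun _ => Or.inr h)).mul
    continuous_id

lemma measurePreserving_reflect {σ : ℝ} (hσ : σ = 1 ∨ σ = -1) :
    MeasurePreserving (fun z : ℝ × Rn n => (σ * z.1, z.2)) volume volume := by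
  have h : MeasurePreserving (fun t : ℝ => σ * t) volume volume := by
    rcases hσ with rfl | rfl
    · simpa using! MeasurePreserving.id volume
    · simpa using! Measure.measurePreserving_neg (volume : Measure ℝ)
  exact h.prod (MeasurePreserving.id volume)

lemma quasiMeasurePreserving_reflect {σ : ℝ} (hσ : σ = 1 ∨ σ = -1) :
    Measure.QuasiMeasurePreserving (fun t : ℝ => σ * t) volume volume := by
  rcases hσ with rfl | rfl
  · simpa using! (MeasurePreserving.id (volume : Measure ℝ)).quasiMeasurePreserving
  · simpa using! (Measure.measurePreserving_neg (volume : Measure ℝ)).quasiMeasurePreserving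

/-- The nonlinearity along a free solution has a jointly measurable version whose `L^{q'}` norm in
space-time is finite. -/
lemma exists_nonlinearity (hn : 1 ≤ n) (φ : L2 n) {σ : ℝ} (hσ : σ = 1 ∨ σ = -1) :
    ∃ w : ℝ × Rn n → ℂ, AEStronglyMeasurable w volume ∧
      ∫⁻ z, ‖w z‖ₑ ^ dualExp n ≠ ∞ ∧
      ∀ᵐ t : ℝ, (fun x => w (t, x)) =ᵐ[volume] criticalPower (freeFlow (σ * t) φ) := by
  obtain ⟨v, hv, hvae⟩ := exists_memLp_freeFlow hn φ
  have hq := two_lt_strichartzExp hn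
  have hq0 : 0 < strichartzExp n := by linarith
  have hpq := holderConjugate_dualExp hn
  have hv' := hv.comp_measurePreserving (measurePreserving_reflect hσ)
  -- The sign σ lets one argument serve both half-lines. The integrability of the power reduces to
  -- that of |v|^q since (q - 1)q' = q.
  refine ⟨fun z => ((‖v (σ * z.1, z.2)‖ ^ (4 / (n : ℝ)) : ℝ) : ℂ) * v (σ * z.1, z.2),
    (continuous_power_mul (n := n)).comp_aestronglyMeasurable hv'.1, ?_, ?_⟩
  · have h := lintegral_rpow_enorm_lt_top_of_eLpNorm_lt_top (by simpa using hq0)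
      ENNReal.ofReal_ne_top hv'.2
    rw [ENNReal.toReal_ofReal hq0.le] at h
    convert h.ne using 3 with z
    have hexp : (strichartzExp n - 1) * dualExp n = strichartzExp n := by
      have := hpq.mul_eq_add
      linarith
    rw [← ofReal_norm, norm_power_mul, ENNReal.ofReal_rpow_of_nonneg (by positivity) hpq.pos.le,
      ← Real.rpow_mul (norm_nonneg _), hexp, ← ofReal_norm,
      ENNReal.ofReal_rpow_of_nonneg (norm_nonneg _) hq0.le]
    rfl
  · filter_upwards [(quasiMeasurePreserving_reflect hσ).ae hvae] with t ht
    filter_upwards [ht] with x hx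
    rw [hx, criticalPower]

lemma isTempered_of_nonlinearity (hn : 1 ≤ n) {w : ℝ × Rn n → ℂ}
    (hw : AEStronglyMeasurable w volume) (hfin : ∫⁻ z, ‖w z‖ₑ ^ dualExp n ≠ ∞)
    {f : ℝ → Rn n → ℂ} (hf : ∀ᵐ t : ℝ, (fun x => w (t, x)) =ᵐ[volume] f t) :
    ∀ᵐ t : ℝ, IsTempered (f t) := by
  have hpq := holderConjugate_dualExp hn
  have hp0 := hpq.pos
  have : Fact (1 ≤ ENNReal.ofReal (dualExp n)) :=
    ⟨by rw [← ENNReal.ofReal_one]; exact ENNReal.ofReal_le_ofReal hpq.lt.le⟩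
  have hm : AEMeasurable (fun z => ‖w z‖ₑ ^ dualExp n) (volume.prod volume) :=
    hw.enorm.pow_const _
  rw [Measure.volume_eq_prod, lintegral_prod _ hm] at hfin
  have hlt := ae_lt_top' hm.lintegral_prod_right' hfin
  filter_upwards [hf, hlt, AEStronglyMeasurable.prodMk_left (μ := volume) (ν := volume) hw]
    with t h1 h2 h3
  refine isTempered_of_ae_eq_memLp (p := ENNReal.ofReal (dualExp n)) ⟨h3, ?_⟩ h1
  rw [eLpNorm_lt_top_iff_lintegral_rpow_enorm_lt_top (by simpa using hp0) ENNReal.ofReal_ne_top,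
    ENNReal.toReal_ofReal hp0.le]
  exact h2

/-! ### The integrands tested against Schwartz functions -/

/-- The pairing `∫ U₀(-t)ψ · |U₀(t)φ|^{4/n} U₀(t)φ dx`. -/
def pairing (φ : L2 n) (t : ℝ) (ψ : 𝓢(Rn n, ℂ)) : ℂ :=
  ∫ x, freeSchwartz (-t) ψ x * criticalPower (freeFlow t φ) x

lemma ae_isTempered (hn : 1 ≤ n) (φ : L2 n) {σ : ℝ} (hσ : σ = 1 ∨ σ = -1) :
    ∀ᵐ t : ℝ, IsTempered (criticalPower (freeFlow (σ * t) φ)) := by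
  obtain ⟨w, hw, hfin, hae⟩ := exists_nonlinearity hn φ hσ
  exact isTempered_of_nonlinearity hn hw hfin hae

/-- Both operations act on distributions by transposition; on the test function, the Fourier
transform after the chirp is the flow at time -t after the Fourier transform. -/
lemma leftIntegrand_apply {φ : L2 n} {t : ℝ} (ht : IsTempered (criticalPower (freeFlow t φ)))
    (ψ : 𝓢(Rn n, ℂ)) : leftIntegrand φ t ψ = pairing φ t (fourierSchwartz n ψ) := by
  have h : leftIntegrand φ t ψ = distOf (criticalPower (freeFlow t φ))
      (fourierSchwartz n (SchwartzMap.smulLeftCLM ℂ (chirp t) ψ)) := rfl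
  rw [h, fourierSchwartz_chirp, distOf_apply ht, pairing]

lemma rightIntegrand_apply {φ : L2 n} {t : ℝ}
    (ht : IsTempered (criticalPower (freeFlow (-t) (fourierL2 φ)))) (ψ : 𝓢(Rn n, ℂ)) :
    rightIntegrand φ t ψ = pairing (fourierL2 φ) (-t) ψ := by
  rw [rightIntegrand, freeFlowDist, TemperedDistribution.fourierMultiplierCLM_apply_apply,
    fourier_freeSymbol_fourierInv, distOf_apply ht, pairing, neg_neg]

/-! ### Time integrals of the pairing -/

/-- The space-time product `U₀(-σt)ψ(x) w(t,x)`. -/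
def spaceTimeProduct (w : ℝ × Rn n → ℂ) (σ : ℝ) (ψ : 𝓢(Rn n, ℂ)) (z : ℝ × Rn n) : ℂ :=
  freeSchwartz (-(σ * z.1)) ψ z.2 * w z

lemma aestronglyMeasurable_spaceTimeProduct {w : ℝ × Rn n → ℂ} (hw : AEStronglyMeasurable w volume)
    (σ : ℝ) (ψ : 𝓢(Rn n, ℂ)) : AEStronglyMeasurable (spaceTimeProduct w σ ψ) volume := by
  have h := (continuous_freeSchwartz_uncurry ψ).comp
    (by fun_prop : Continuous fun z : ℝ × Rn n => (-(σ * z.1), z.2))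
  exact h.aestronglyMeasurable.mul hw

lemma lintegral_reflected_freeSchwartz_le (hn : 1 ≤ n) {σ : ℝ} (hσ : σ = 1 ∨ σ = -1)
    (ψ : 𝓢(Rn n, ℂ)) :
    ∫⁻ z : ℝ × Rn n, ‖freeSchwartz (-(σ * z.1)) ψ z.2‖ₑ ^ strichartzExp n
      ≤ (strichartzConst n * ‖(ψ.toLp 2 : L2 n)‖ₑ) ^ strichartzExp n := by
  have hσ' : -σ = 1 ∨ -σ = -1 := by
    rcases hσ with rfl | rfl <;> simp
  have h := (measurePreserving_reflect (n := n) hσ').lintegral_comp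
    (measurable_enorm_freeSchwartz_rpow ψ (strichartzExp n))
  simp only [neg_mul] at h
  rw [h]
  exact lintegral_freeSchwartz_rpow_le hn ψ

/-- Hölder in space-time, with Strichartz for the factor containing ψ. Only w is measured over A, so
the bound becomes small when A is a tail. -/
lemma lintegral_spaceTimeProduct_le (hn : 1 ≤ n) {σ : ℝ} (hσ : σ = 1 ∨ σ = -1)
    {w : ℝ × Rn n → ℂ} (hw : AEStronglyMeasurable w volume) (ψ : 𝓢(Rn n, ℂ)) (A : Set ℝ) :
    ∫⁻ z, ‖spaceTimeProduct w σ ψ z‖ₑ ∂((volume.restrict A).prod volume)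
      ≤ strichartzConst n * ‖(ψ.toLp 2 : L2 n)‖ₑ *
        (∫⁻ z, ‖w z‖ₑ ^ dualExp n ∂((volume.restrict A).prod volume)) ^ (1 / dualExp n) := by
  have hq := two_lt_strichartzExp hn
  have hq0 : 0 < strichartzExp n := by linarith
  have hle : (volume.restrict A).prod (volume : Measure (Rn n)) ≤ volume := by
    rw [Measure.volume_eq_prod]
    exact Measure.prod_mono Measure.restrict_le_self le_rfl
  have hu : Measurable fun z : ℝ × Rn n => freeSchwartz (-(σ * z.1)) ψ z.2 :=
    ((continuous_freeSchwartz_uncurry ψ).comp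
      (by fun_prop : Continuous fun z : ℝ × Rn n => (-(σ * z.1), z.2))).measurable
  have hw' := hw.mono_measure hle
  simp only [spaceTimeProduct, enorm_mul]
  refine (ENNReal.lintegral_mul_le_Lp_mul_Lq _ (holderConjugate_dualExp hn).symm
    hu.enorm.aemeasurable hw'.enorm).trans (mul_le_mul_left ?_ _)
  refine (ENNReal.rpow_le_rpow ((lintegral_mono' hle le_rfl).trans
    (lintegral_reflected_freeSchwartz_le hn hσ ψ)) (by positivity)).trans_eq ?_
  rw [← ENNReal.rpow_mul, mul_one_div_cancel hq0.ne', ENNReal.rpow_one]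

lemma integrable_spaceTimeProduct (hn : 1 ≤ n) {σ : ℝ} (hσ : σ = 1 ∨ σ = -1)
    {w : ℝ × Rn n → ℂ} (hw : AEStronglyMeasurable w volume)
    (hfin : ∫⁻ z, ‖w z‖ₑ ^ dualExp n ≠ ∞) (ψ : 𝓢(Rn n, ℂ)) :
    Integrable (spaceTimeProduct w σ ψ) (volume.prod volume) := by
  refine ⟨aestronglyMeasurable_spaceTimeProduct hw σ ψ, ?_⟩
  have h := lintegral_spaceTimeProduct_le hn hσ hw ψ univ
  rw [Measure.restrict_univ] at h
  refine h.trans_lt (ENNReal.mul_lt_top (ENNReal.mul_lt_top (strichartzConst_ne_top n).lt_top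
    (by simp)) ?_)
  exact (ENNReal.rpow_ne_top_of_nonneg (by have := (holderConjugate_dualExp hn).pos; positivity)
    hfin).lt_top

/-- The dual Strichartz estimate: the time integral over a set of times is an element of `L²`. -/
lemma exists_L2_setIntegral (hn : 1 ≤ n) {σ : ℝ} (hσ : σ = 1 ∨ σ = -1)
    {w : ℝ × Rn n → ℂ} (hw : AEStronglyMeasurable w volume)
    (hfin : ∫⁻ z, ‖w z‖ₑ ^ dualExp n ≠ ∞) (S : 𝓢(Rn n, ℂ) →L[ℂ] 𝓢(Rn n, ℂ))
    (hS : ∀ ψ, ‖((S ψ).toLp 2 : L2 n)‖ = ‖(ψ.toLp 2 : L2 n)‖) (A : Set ℝ) :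
    ∃ J : L2 n, ‖J‖ ≤ (strichartzConst n *
        (∫⁻ t in A, ∫⁻ x, ‖w (t, x)‖ₑ ^ dualExp n) ^ (1 / dualExp n)).toReal ∧
      ∀ ψ, ∫ t in A, ∫ x, spaceTimeProduct w σ (S ψ) (t, x) = (J : 𝓢'(Rn n, ℂ)) ψ := by
  have hp0 := (holderConjugate_dualExp hn).pos
  have hle : (volume.restrict A).prod (volume : Measure (Rn n)) ≤ volume := by
    rw [Measure.volume_eq_prod]
    exact Measure.prod_mono Measure.restrict_le_self le_rfl
  have hI : ∀ ψ, Integrable (spaceTimeProduct w σ ψ) ((volume.restrict A).prod volume) :=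
    fun ψ => (integrable_spaceTimeProduct hn hσ hw hfin ψ).mono_measure hle
  have hB : ∫⁻ t in A, ∫⁻ x, ‖w (t, x)‖ₑ ^ dualExp n
      = ∫⁻ z, ‖w z‖ₑ ^ dualExp n ∂((volume.restrict A).prod volume) :=
    (lintegral_prod _ ((hw.mono_measure hle).enorm.pow_const _)).symm
  have hBfin : (∫⁻ t in A, ∫⁻ x, ‖w (t, x)‖ₑ ^ dualExp n) ^ (1 / dualExp n) ≠ ∞ := by
    refine ENNReal.rpow_ne_top_of_nonneg (by positivity) ?_
    rw [hB]
    exact ((lintegral_mono' hle le_rfl).trans_lt hfin.lt_top).ne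
  let Λ : 𝓢(Rn n, ℂ) →ₗ[ℂ] ℂ :=
    { toFun := fun ψ => ∫ z, spaceTimeProduct w σ (S ψ) z ∂((volume.restrict A).prod volume)
      map_add' := fun ψ χ => by
        rw [← integral_add (hI _) (hI _)]
        congr 1
        funext z
        simp only [spaceTimeProduct, map_add]
        exact add_mul _ _ _
      map_smul' := fun c ψ => by
        rw [RingHom.id_apply, smul_eq_mul, ← integral_const_mul]
        congr 1
        funext z
        simp only [spaceTimeProduct, map_smul]
        exact mul_assoc _ _ _ }
  have hΛ : ∀ ψ, ‖Λ ψ‖ ≤ (strichartzConst n *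
      (∫⁻ t in A, ∫⁻ x, ‖w (t, x)‖ₑ ^ dualExp n) ^ (1 / dualExp n)).toReal *
        ‖(ψ.toLp 2 : L2 n)‖ := by
    intro ψ
    have h : ‖Λ ψ‖ₑ ≤ strichartzConst n *
        (∫⁻ t in A, ∫⁻ x, ‖w (t, x)‖ₑ ^ dualExp n) ^ (1 / dualExp n) *
          ‖(ψ.toLp 2 : L2 n)‖ₑ := by
      refine (enorm_integral_le_lintegral_enorm _).trans
        ((lintegral_spaceTimeProduct_le hn hσ hw (S ψ) A).trans_eq ?_)
      have hSe : ‖((S ψ).toLp 2 : L2 n)‖ₑ = ‖(ψ.toLp 2 : L2 n)‖ₑ :=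
        enorm_eq_iff_norm_eq.2 (hS ψ)
      rw [hB, hSe]
      ring
    rw [← toReal_enorm, ← toReal_enorm, ← ENNReal.toReal_mul]
    exact ENNReal.toReal_mono (ENNReal.mul_ne_top
      (ENNReal.mul_ne_top (strichartzConst_ne_top n) hBfin) (by simp)) h
  obtain ⟨J, hJ1, hJ2⟩ := exists_L2_representing Λ ENNReal.toReal_nonneg hΛ
  refine ⟨J, hJ1, fun ψ => ?_⟩
  rw [← hJ2 ψ]
  exact (integral_prod _ (hI (S ψ))).symm

/-- The measure with density β is finite, hence continuous along the decreasing half-lines, whose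
intersection is empty. -/
lemma tendsto_setLIntegral_Ioi_zero {β : ℝ → ℝ≥0∞} (hfin : ∫⁻ t, β t ≠ ∞) :
    Tendsto (fun T : ℝ => ∫⁻ t in Ioi T, β t) atTop (𝓝 0) := by
  set ν : Measure ℝ := volume.withDensity β with hν
  have hfm : IsFiniteMeasure ν := isFiniteMeasure_withDensity hfin
  have h : Tendsto (fun T : ℝ => ν (Ioi T)) atTop (𝓝 (ν (⋂ T : ℝ, Ioi T))) :=
    tendsto_measure_iInter_atTop (fun T => measurableSet_Ioi.nullMeasurableSet)
      (fun S T hST => Ioi_subset_Ioi hST) ⟨0, measure_ne_top _ _⟩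
  have h0 : ⋂ T : ℝ, Ioi T = ∅ := by
    refine eq_empty_of_forall_notMem fun x hx => ?_
    exact lt_irrefl x (mem_iInter.1 hx x)
  rw [h0, measure_empty] at h
  refine h.congr fun T => ?_
  rw [hν, withDensity_apply _ measurableSet_Ioi]

/-- A family of tempered distributions which is given by the pairing along a free solution has an
integral in `L²`. -/
lemma exists_hasIntegralToTop (hn : 1 ≤ n) (φ : L2 n) {σ : ℝ} (hσ : σ = 1 ∨ σ = -1)
    (S : 𝓢(Rn n, ℂ) →L[ℂ] 𝓢(Rn n, ℂ))
    (hS : ∀ ψ, ‖((S ψ).toLp 2 : L2 n)‖ = ‖(ψ.toLp 2 : L2 n)‖) {f : ℝ → 𝓢'(Rn n, ℂ)}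
    (hf : ∀ᵐ t : ℝ, ∀ ψ, f t ψ = pairing φ (σ * t) (S ψ)) : ∃ I : L2 n, HasIntegralToTop f I := by
  have hp0 := (holderConjugate_dualExp hn).pos
  obtain ⟨w, hw, hfin, hae⟩ := exists_nonlinearity hn φ hσ
  have hm : AEMeasurable (fun z => ‖w z‖ₑ ^ dualExp n) (volume.prod volume) :=
    hw.enorm.pow_const _
  have hβ : ∫⁻ t, ∫⁻ x, ‖w (t, x)‖ₑ ^ dualExp n ≠ ∞ := by
    rw [← lintegral_prod _ hm]
    exact hfin
  have hfae : ∀ ψ, ∀ᵐ t : ℝ, f t ψ = ∫ x, spaceTimeProduct w σ (S ψ) (t, x) := by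
    intro ψ
    filter_upwards [hf, hae] with t h1 h2
    rw [h1, pairing]
    refine integral_congr_ae ?_
    filter_upwards [h2] with x hx
    simp only [spaceTimeProduct]
    rw [hx]
  have h_int : ∀ ψ, Integrable (fun t => f t ψ) := fun ψ =>
    ((integrable_spaceTimeProduct hn hσ hw hfin (S ψ)).integral_prod_left).congr
      ((hfae ψ).mono fun t ht => ht.symm)
  have hset : ∀ (A : Set ℝ) ψ, ∫ t in A, f t ψ
      = ∫ t in A, ∫ x, spaceTimeProduct w σ (S ψ) (t, x) := fun A ψ =>
    integral_congr_ae (ae_restrict_of_ae (hfae ψ))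
  choose J hJn hJ using fun A : Set ℝ => exists_L2_setIntegral hn hσ hw hfin S hS A
  have hlim : Tendsto (fun T : ℝ => J (Ioi T)) atTop (𝓝 0) := by
    rw [tendsto_zero_iff_norm_tendsto_zero]
    refine squeeze_zero (fun _ => norm_nonneg _) (fun T => hJn (Ioi T)) ?_
    have h1 : Tendsto (fun T : ℝ => (∫⁻ t in Ioi T, ∫⁻ x, ‖w (t, x)‖ₑ ^ dualExp n)
        ^ (1 / dualExp n)) atTop (𝓝 0) := by
      have := ((ENNReal.continuous_rpow_const (y := 1 / dualExp n)).tendsto 0).comp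
        (tendsto_setLIntegral_Ioi_zero hβ)
      rwa [ENNReal.zero_rpow_of_pos (by positivity)] at this
    have h2 := ENNReal.Tendsto.const_mul (a := strichartzConst n) h1
      (Or.inr (strichartzConst_ne_top n))
    rw [mul_zero] at h2
    have h3 := (ENNReal.tendsto_toReal ENNReal.zero_ne_top).comp h2
    rwa [ENNReal.toReal_zero] at h3
  -- The partial integral is the whole minus the tail, so norm convergence is just the vanishing of
  -- the tail. For T ≤ 0 the family has no role.
  refine ⟨J (Ioi 0), fun ψ => (h_int ψ).integrableOn, fun ψ => ?_,
    fun T => J (Ioi 0) - J (Ioi T), fun T hT ψ => ?_, ?_⟩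
  · rw [hset, hJ]
  · have h1 : ∫ t in Ioi (0 : ℝ), f t ψ
        = (∫ t in Ioc 0 T, f t ψ) + ∫ t in Ioi T, f t ψ := by
      rw [← setIntegral_union (Ioc_disjoint_Ioi le_rfl) measurableSet_Ioi
        (h_int ψ).integrableOn (h_int ψ).integrableOn, Ioc_union_Ioi_eq_Ioi (le_of_lt hT)]
    have h2 : ((J (Ioi 0) - J (Ioi T) : L2 n) : 𝓢'(Rn n, ℂ)) ψ
        = (J (Ioi 0) : 𝓢'(Rn n, ℂ)) ψ - (J (Ioi T) : 𝓢'(Rn n, ℂ)) ψ := by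
      have h3 := map_sub (Lp.toTemperedDistributionCLM ℂ (volume : Measure (Rn n)) 2)
        (J (Ioi 0)) (J (Ioi T))
      exact DFunLike.congr_fun h3 ψ
    rw [h2, ← hJ, ← hJ, ← hset, ← hset, h1, add_sub_cancel_right]
  · simpa using tendsto_const_nhds.sub hlim

/-! ### The pseudoconformal change of variables -/

/-- The square of the unitary Fourier transform is the reflection, which commutes with the flow
because the kernel is even. -/
lemma freeSchwartz_fourierSchwartz_fourierSchwartz {t : ℝ} (ht : t ≠ 0) (ψ : 𝓢(Rn n, ℂ))
    (x : Rn n) :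
    freeSchwartz t (fourierSchwartz n (fourierSchwartz n ψ)) x = freeSchwartz t ψ (-x) := by
  rw [freeSchwartz_eq_integral_kernel ht, freeSchwartz_eq_integral_kernel ht,
    ← integral_neg_eq_self]
  congr 2
  funext y
  rw [fourierSchwartz_fourierSchwartz, neg_neg, ← chirp_neg]
  congr 2
  abel

/-- The phases have modulus one and |t|^{-n/2} raised to the power 4/n is |t|^{-2}: this is where
L²-criticality enters. -/
lemma criticalPower_conformal {t : ℝ} (ht : t ≠ 0) (hn : 1 ≤ n) (φ : L2 n) :
    ∀ᵐ x, criticalPower (freeFlow t φ) x = ((|t| ^ (-2 : ℝ) : ℝ) : ℂ) *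
      (conformalConst n t * chirp (1 / t) x *
        criticalPower (freeFlow (-(1 / t)) (fourierL2 φ)) (t⁻¹ • x)) := by
  have hn0 : (n : ℝ) ≠ 0 := by positivity
  filter_upwards [freeFlow_ae_eq_conformal ht φ] with x hx
  rw [criticalPower, criticalPower, hx, norm_mul, norm_mul, norm_chirp, mul_one,
    norm_conformalConst ht, Real.mul_rpow (by positivity) (norm_nonneg _),
    ← Real.rpow_mul (abs_nonneg t), show -(n : ℝ) / 2 * (4 / n) = -2 by field_simp; norm_num]
  push_cast
  ring

/-- Both factors are transformed, at the opposite times -t and t. Their chirps cancel, their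
constants multiply to |t|^{-n}, and this is compensated by the Jacobian of x ↦ x/t. -/
lemma pairing_conformal {t : ℝ} (ht : t ≠ 0) (hn : 1 ≤ n) (φ : L2 n) (ψ : 𝓢(Rn n, ℂ)) :
    pairing φ t (fourierSchwartz n ψ)
      = ((|t| ^ (-2 : ℝ) : ℝ) : ℂ) * pairing (fourierL2 φ) (-(1 / t)) ψ := by
  have h1 : pairing φ t (fourierSchwartz n ψ) = ∫ x, ((|t| ^ (-2 : ℝ) : ℝ) : ℂ) *
      (((|t| ^ (-(n : ℝ)) : ℝ) : ℂ) * (freeSchwartz (1 / t) ψ (t⁻¹ • x) *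
        criticalPower (freeFlow (-(1 / t)) (fourierL2 φ)) (t⁻¹ • x))) := by
    rw [pairing]
    refine integral_congr_ae ?_
    filter_upwards [criticalPower_conformal ht hn φ] with x hx
    have h2 : freeSchwartz (-t) (fourierSchwartz n ψ) x
        = conformalConst n (-t) * chirp (-(1 / t)) x * freeSchwartz (1 / t) ψ (t⁻¹ • x) := by
      rw [freeSchwartz_eq_conformal (neg_ne_zero.2 ht), div_neg, neg_neg,
        freeSchwartz_fourierSchwartz_fourierSchwartz (one_div_ne_zero ht), inv_neg, neg_smul,
        neg_neg]
    rw [hx, h2, ← conformalConst_mul_neg ht]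
    linear_combination ((|t| ^ (-2 : ℝ) : ℝ) : ℂ) * conformalConst n t * conformalConst n (-t) *
      freeSchwartz (1 / t) ψ (t⁻¹ • x) *
      criticalPower (freeFlow (-(1 / t)) (fourierL2 φ)) (t⁻¹ • x) * chirp_mul_chirp_neg (1 / t) x
  rw [h1, integral_const_mul, integral_const_mul, Measure.integral_comp_smul
    (volume : Measure (Rn n)) (fun y => freeSchwartz (1 / t) ψ y *
      criticalPower (freeFlow (-(1 / t)) (fourierL2 φ)) y) t⁻¹, finrank_euclideanSpace_fin,
    Complex.real_smul, ← mul_assoc (((|t| ^ (-(n : ℝ)) : ℝ) : ℂ)), ← Complex.ofReal_mul,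
    pairing, neg_neg]
  have h3 : |t| ^ (-(n : ℝ)) * |(t⁻¹ ^ n)⁻¹| = 1 := by
    rw [inv_pow, inv_inv, abs_pow, ← Real.rpow_natCast, ← Real.rpow_add (abs_pos.2 ht),
      neg_add_cancel, Real.rpow_zero]
  rw [h3, Complex.ofReal_one, one_mul]

/-- The substitution t ↦ 1/t preserves each half-line, and its Jacobian t^{-2} is the factor in
`pairing_conformal`. -/
lemma integral_pairing_conformal (hn : 1 ≤ n) {σ : ℝ} (hσ : σ = 1 ∨ σ = -1) (φ : L2 n)
    (ψ : 𝓢(Rn n, ℂ)) :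
    ∫ t in Ioi (0 : ℝ), pairing φ (σ * t) (fourierSchwartz n ψ)
      = ∫ t in Ioi (0 : ℝ), pairing (fourierL2 φ) (-(σ * t)) ψ := by
  rw [← integral_comp_rpow_Ioi (fun s => pairing (fourierL2 φ) (-(σ * s)) ψ)
    (p := -1) (by norm_num)]
  refine setIntegral_congr_fun measurableSet_Ioi fun t ht => ?_
  have ht0 : 0 < t := ht
  have hσ0 : σ ≠ 0 := by rcases hσ with rfl | rfl <;> norm_num
  have hσt : 1 / (σ * t) = σ * t ^ (-1 : ℝ) := by
    rw [Real.rpow_neg_one]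
    rcases hσ with rfl | rfl <;> field_simp
  have habs : |σ * t| = t := by
    rcases hσ with rfl | rfl <;> simp [abs_of_pos ht0]
  rw [pairing_conformal (mul_ne_zero hσ0 ht0.ne') hn, hσt, habs, Complex.real_smul]
  norm_num

/-- Both time integrals exist in `L²` and coincide. -/
lemma exists_common_integral (hn : 1 ≤ n) {σ : ℝ} (hσ : σ = 1 ∨ σ = -1) (φ : L2 n) :
    ∃ I : L2 n, HasIntegralToTop (fun t => leftIntegrand φ (σ * t)) I ∧
      HasIntegralToTop (fun t => rightIntegrand φ (σ * t)) I := by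
  have hσ' : -σ = 1 ∨ -σ = -1 := by
    rcases hσ with rfl | rfl <;> simp
  have hleft : ∀ᵐ t : ℝ, ∀ ψ,
      leftIntegrand φ (σ * t) ψ = pairing φ (σ * t) (fourierSchwartz n ψ) := by
    filter_upwards [ae_isTempered hn φ hσ] with t ht ψ
    exact leftIntegrand_apply ht ψ
  have hright : ∀ᵐ t : ℝ, ∀ ψ,
      rightIntegrand φ (σ * t) ψ = pairing (fourierL2 φ) (-σ * t) ψ := by
    filter_upwards [ae_isTempered hn (fourierL2 φ) hσ'] with t ht ψ
    rw [neg_mul] at ht ⊢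
    exact rightIntegrand_apply ht ψ
  -- The left side tests with the Fourier transform of ψ, the right side with ψ itself; both maps
  -- preserve the L² norm.
  obtain ⟨I, hI⟩ := exists_hasIntegralToTop hn φ hσ (fourierSchwartz n)
    (fun ψ => by rw [← fourierL2_toLp, norm_fourierL2]) hleft
  obtain ⟨I', hI'⟩ := exists_hasIntegralToTop hn (fourierL2 φ) hσ'
    (ContinuousLinearMap.id ℂ 𝓢(Rn n, ℂ)) (fun ψ => rfl) hright
  have heq : I' = I := by
    refine eq_of_forall_schwartz fun ψ => ?_
    rw [← hI.integral_eq ψ, ← hI'.integral_eq ψ,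
      integral_congr_ae (ae_restrict_of_ae (hleft.mono fun t ht => ht ψ)),
      integral_congr_ae (ae_restrict_of_ae (hright.mono fun t ht => ht ψ)),
      integral_pairing_conformal hn hσ]
    simp only [neg_mul]
  exact ⟨I, hI, heq ▸ hI'⟩

end CriticalNLS

end

theorem corollary2 (n : ℕ) (hn : 1 ≤ n) (φ : CriticalNLS.L2 n) :
    (∀ᵐ t : ℝ, CriticalNLS.IsTempered
      (CriticalNLS.criticalPower (CriticalNLS.freeFlow t φ))) ∧
    (∀ᵐ t : ℝ, CriticalNLS.IsTempered
      (CriticalNLS.criticalPower (CriticalNLS.freeFlow (-t) (CriticalNLS.fourierL2 φ)))) ∧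
    (∃ I : CriticalNLS.L2 n,
      CriticalNLS.HasIntegralToTop (CriticalNLS.leftIntegrand φ) I ∧
      CriticalNLS.HasIntegralToTop (CriticalNLS.rightIntegrand φ) I) ∧
    (∃ I : CriticalNLS.L2 n,
      CriticalNLS.HasIntegralToBot (CriticalNLS.leftIntegrand φ) I ∧
      CriticalNLS.HasIntegralToBot (CriticalNLS.rightIntegrand φ) I) := by
  refine ⟨?_, ?_, ?_, ?_⟩
  · simpa only [one_mul] using CriticalNLS.ae_isTempered hn φ (Or.inl rfl)
  · simpa only [neg_one_mul] using
      CriticalNLS.ae_isTempered hn (CriticalNLS.fourierL2 φ) (Or.inr rfl)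
  · simpa only [one_mul] using CriticalNLS.exists_common_integral hn (Or.inl rfl) φ
  · obtain ⟨I, h1, h2⟩ := CriticalNLS.exists_common_integral hn (Or.inr rfl) φ
    simp only [neg_one_mul] at h1 h2
    -- The integral to -∞ is minus the integral of the time-reflected family over the positive
    -- half-line.
    refine ⟨-I, ?_, ?_⟩
    · rw [CriticalNLS.HasIntegralToBot, neg_neg]
      exact h1
    · rw [CriticalNLS.HasIntegralToBot, neg_neg]
      exact h2
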